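/- Let $\mu$ be a probability law on $\mathbb R$ with mean $0$ and variance $1$ such that (i) for some $\delta_0>0$, $\int e^{\delta y}\,\mu(dy)<\infty$ for all $\delta\in(-\delta_0,\delta_0)$, and (ii) $\mu$ has a log-concave density $f$, i.e. $f(\theta x+(1-\theta)y)\ge f(x)^\theta f(y)^{1-\theta}$ for all $x,y\in\mathbb R$, $\theta\in[0,1]$. For $d\ge 1$ and $x\in\mathbb R^d$ let $S_j(t)=x_j+\sum_{i\ge1}X_{ij}\mathbf 1\{\sum_{k=1}^i e_{kj}\le t\}$, $1\le j\le d$, $t\ge 0$, where all $e_{ij}$ and $X_{ij}$ are independent, the $e_{ij}$ are exponential with rate $1$ and the $X_{ij}$ have law $\mu$. Let $W^d=\{x\in\mathbb R^d:x_1<\dots<x_d\}$, $\tau=\inf\{t\ge0:S(t)\notin W^d\}$, $\Delta(x)=\prod_{1\le i<j\le d}(x_j-x_i)$, and let $$V(x)=\lim_{t\to\infty}\mathbf E_x[\Delta(S(t));\,\tau>t]$$ be the harmonic function of the ordered random walks. For $T,\varepsilon>0$ let $W_{T,\varepsilon}=\{x\in\mathbb R^d:x_{j+1}-x_j>T^{1/2-\varepsilon},\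 1\le j<d\}$. Let $\varepsilon>0$ and let $a$ be real with $2a<1/2-\varepsilon$. Then $V(x)\sim\Delta(x)$ as $T\to\infty$, uniformly in $d\le T^a$ and $x\in W_{T,\varepsilon}$. That is, for every $\eta>0$ there is $T_0>0$ such that for all $T\ge T_0$, all integers $1\le d\le T^a$ and all $x\in W_{T,\varepsilon}\subset\mathbb R^d$, the random variables $\Delta(S(t))\mathbf 1\{\tau>t\}$, $t\ge0$, are integrable, the limit defining $V(x)$ exists in $\mathbb R$, and $$\left|\frac{V(x)}{\Delta(x)}-1\right|\le\eta .$$ -/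

import Mathlib

open MeasureTheory ProbabilityTheory Filter Topology

noncomputable section

namespace OrderedWalk

/-- The Weyl chamber `{x : x₁ < x₂ < ⋯ < x_d}`. -/
def weylChamber (d : ℕ) : Set (Fin d → ℝ) := {x | StrictMono x}

/-- The Vandermonde determinant `∏_{i < j} (x_j - x_i)`. -/
def vandermonde {d : ℕ} (x : Fin d → ℝ) : ℝ :=
  ∏ i : Fin d, ∏ j ∈ Finset.Ioi i, (x j - x i)

/-- The points of `ℝ^d` all of whose gaps `x_{j+1} - x_j` exceed `T^{1/2-ε}`. -/
def spacedSet (d : ℕ) (T ε : ℝ) : Set (Fin d → ℝ) :=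
  {x | ∀ (j : ℕ) (hj : j + 1 < d),
    T ^ (1 / 2 - ε) < x ⟨j + 1, hj⟩ - x ⟨j, (Nat.lt_succ_self j).trans hj⟩}

/-- `f` is a log-concave probability density of the law `μ`. -/
structure IsLogConcaveDensity (μ : Measure ℝ) (f : ℝ → ℝ) : Prop where
  measurable : Measurable f
  nonneg : ∀ x, 0 ≤ f x
  density : μ = volume.withDensity (fun x => ENNReal.ofReal (f x))
  logConcave : ∀ x y θ : ℝ, 0 ≤ θ → θ ≤ 1 →
    f x ^ θ * f y ^ (1 - θ) ≤ f (θ * x + (1 - θ) * y)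

/-- Sample points: for every step number `i` (counted from `0`) and every walker `j`, the pair
`(e_{ij}, X_{ij})` of a waiting time and a jump. -/
abbrev Sample (d : ℕ) : Type := ℕ × Fin d → ℝ × ℝ

/-- The law under which all the waiting times `e_{ij}` and all the jumps `X_{ij}` are independent,
the `e_{ij}` are exponential with rate `1` and the `X_{ij}` have law `μ`. -/
def walkMeasure (μ : Measure ℝ) [IsProbabilityMeasure μ] (d : ℕ) : Measure (Sample d) :=
  haveI : IsProbabilityMeasure (expMeasure 1) := isProbabilityMeasure_expMeasure one_pos
  Measure.infinitePi (fun _ : ℕ × Fin d => (expMeasure 1).prod μ)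

/-- The time of the `i`-th jump (counted from `0`) of walker `j`. -/
def jumpTime {d : ℕ} (ω : Sample d) (i : ℕ) (j : Fin d) : ℝ :=
  ∑ k ∈ Finset.range (i + 1), (ω (k, j)).1

open Classical in
/-- The position at time `t` of the continuous-time random walks started from `x`: walker `j` is at
`x_j + ∑_i X_{ij} 1{e_{0j} + ⋯ + e_{ij} ≤ t}`. Almost surely the sum has finitely many nonzero
terms. -/
def walk {d : ℕ} (x : Fin d → ℝ) (t : ℝ) (ω : Sample d) : Fin d → ℝ :=
  fun j => x j + ∑' i : ℕ, if jumpTime ω i j ≤ t then (ω (i, j)).2 else 0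

/-- The exit time `τ = inf {t ≥ 0 : S(t) ∉ W^d}`, with `inf ∅ = ∞`. -/
def exitTime {d : ℕ} (x : Fin d → ℝ) (ω : Sample d) : EReal :=
  sInf ((fun t : ℝ => (t : EReal)) '' {t : ℝ | 0 ≤ t ∧ walk x t ω ∉ weylChamber d})

/-- The event `{τ > t}`. -/
def survival {d : ℕ} (x : Fin d → ℝ) (t : ℝ) : Set (Sample d) :=
  {ω | (t : EReal) < exitTime x ω}

/-- The expectation `E_x[Δ(S(t)); τ > t]`. -/
def killedVandermonde (μ : Measure ℝ) [IsProbabilityMeasure μ] {d : ℕ} (x : Fin d → ℝ) (t : ℝ) :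
    ℝ :=
  ∫ ω in survival x t, vandermonde (walk x t ω) ∂(walkMeasure μ d)

/-- The harmonic function `V(x) = lim_{t → ∞} E_x[Δ(S(t)); τ > t]` of the ordered random walks. -/
def harmonicV (μ : Measure ℝ) [IsProbabilityMeasure μ] {d : ℕ} (x : Fin d → ℝ) : ℝ :=
  limUnder atTop (fun t : ℝ => killedVandermonde μ x t)

end OrderedWalk

end

/-!
The walk is studied through its jump chain. Since all clocks have rate `1`, the number of jumps made
by time `t` is Poisson of mean `d t` and each jump is made by a uniformly chosen walker. If `Q` is
the transition operator of the jump chain killed outside the Weyl chamber, then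
`E_x[Δ(S(t)); τ > t]` is the Poisson average of the numbers `Q^n Δ (x)`
(`killedVandermonde_eq_tsum`), so the limit `V(x)` is the limit of `Q^n Δ (x)`. The Poisson
description comes from the strong Markov property at the first jump (`lintegral_firstJump`), which
rests on the lack of memory of the exponential law, and from a recursion over the number of jumps
(`lintegral_chainValue`, `chainValue_of_jumpCount`).

The Vandermonde determinant `Δ` is harmonic for the unkilled chain: `∑_j Δ(x + y e_j) = d Δ(x)` for
every `y` (`sum_vandermonde_bump`). So is `Δ_R(x) = Δ(x + R (0, 1, …, d - 1))`. Hence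
`Δ(x) - QΔ(x)` and `Δ_R(x) - QΔ_R(x)` are the expected values of `Δ` and of `Δ_R` after one jump,
restricted to the event that this jump leaves the chamber. When walker `j` jumps over a neighbour
with overshoot `o`, the pair that collides contributes `|o|` to `|Δ|` but about `R` to `Δ_R`, and
the other pairs change by a factor between `2 - e^{θ |o|}` and `e^{θ |o|}`, where `θ` is of order
`(log d) / R` (`abs_vandermonde_bump_le`, `le_vandermonde_spread_bump`). A log-concave density
decays at least geometrically, so the overshoot, conditionally on the exit, has an exponential moment that
is bounded uniformly in the gap (`IsLogConcaveDensity.exists_excess_bound`). Therefore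
`|Δ - QΔ| ≤ κ (Δ_R - QΔ_R)` on the chamber with `κ` of order `1 / R`
(`abs_sum_setIntegral_sub_le`).

Applying `Q^n`, the increments of `Q^n Δ (x)` are dominated by those of the nonnegative
nonincreasing sequence `κ Q^n Δ_R (x)`. So the limit exists and `|V(x) - Δ(x)| ≤ κ Δ_R(x)`
(`exists_tendsto_killedIter`). If all gaps of `x` exceed `L = T^{1/2-ε}` and `d ≤ T^a`, the choice
`R = T^{1/2-ε-2a}` gives `R d² ≤ L`, hence `Δ_R(x) ≤ e Δ(x)` (`vandermonde_spread_le`), while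
`κ → 0` and `(log d) / R → 0`.
-/

open scoped ENNReal

namespace OrderedWalk

/-! ### The Vandermonde determinant -/

/-- The configuration `x + y e_j`: walker `j` has moved by `y`. -/
def bump {d : ℕ} (x : Fin d → ℝ) (j : Fin d) (y : ℝ) : Fin d → ℝ :=
  fun k => x k + if k = j then y else 0

/-- The configuration `x + R (0, 1, …, d - 1)`, whose gaps are those of `x` enlarged by `R`. -/
def spread {d : ℕ} (R : ℝ) (x : Fin d → ℝ) : Fin d → ℝ :=
  fun k => x k + R * (k : ℕ)

theorem vandermonde_eq_det {d : ℕ} (x : Fin d → ℝ) :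
    vandermonde x = (Matrix.vandermonde x).det := by
  rw [Matrix.det_vandermonde]; rfl

/-- The sum over `j` of the determinants of `V` with row `j` replaced by row `j` of `V * P` is
`tr P · det V`. -/
theorem sum_det_updateRow_mul {n : Type*} [Fintype n] [DecidableEq n] (V P : Matrix n n ℝ) :
    ∑ j, (V.updateRow j ((V * P) j)).det = P.trace * V.det := by
  have h : ∀ j, (V.updateRow j ((V * P) j)).det = (V * P * V.adjugate) j j := by
    intro j
    rw [← Matrix.cramer_transpose_apply, Matrix.cramer_eq_adjugate_mulVec, Matrix.mul_apply,
      Matrix.mulVec, dotProduct]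
    refine Finset.sum_congr rfl fun k _ => ?_
    rw [← Matrix.adjugate_transpose, Matrix.transpose_apply, mul_comm]
  simp_rw [h]
  change (V * P * V.adjugate).trace = _
  rw [Matrix.trace_mul_comm, ← Matrix.mul_assoc, Matrix.adjugate_mul, Matrix.smul_mul,
    Matrix.trace_smul, Matrix.one_mul, smul_eq_mul, mul_comm]

/-- The Vandermonde determinant is harmonic for every fixed jump size: the average over the choice
of the walker that moves by `y` does not depend on `y`. -/
theorem sum_vandermonde_bump {d : ℕ} (x : Fin d → ℝ) (y : ℝ) :
    ∑ j, vandermonde (bump x j y) = d * vandermonde x := by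
  -- `(x_j + y)^k` is row `j` of `V * P`, with `P` the unipotent matrix of binomial coefficients.
  let P : Matrix (Fin d) (Fin d) ℝ :=
    Matrix.of fun l k => ((k : ℕ).choose l : ℝ) * y ^ ((k : ℕ) - l)
  have hP : P.trace = d := by
    simp [P, Matrix.trace]
  have hrow : ∀ j, Matrix.vandermonde (bump x j y) =
      (Matrix.vandermonde x).updateRow j ((Matrix.vandermonde x * P) j) := by
    intro j
    ext i k
    by_cases hij : i = j
    · subst hij
      rw [Matrix.updateRow_self, Matrix.vandermonde_apply, Matrix.mul_apply]
      simp only [bump, if_true, Matrix.vandermonde_apply, P, Matrix.of_apply]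
      rw [add_pow, Fin.sum_univ_eq_sum_range
        (fun l => x i ^ l * (((k : ℕ).choose l : ℝ) * y ^ ((k : ℕ) - l))) d]
      rw [← Finset.sum_subset (Finset.range_subset_range.2 (Nat.succ_le_of_lt k.2))]
      · exact Finset.sum_congr rfl fun l _ => by ring
      · intro l _ hl
        rw [Nat.choose_eq_zero_of_lt (by simpa using hl)]; simp
    · rw [Matrix.updateRow_ne hij]
      simp [bump, Matrix.vandermonde_apply, hij]
  simp_rw [vandermonde_eq_det, hrow]
  rw [sum_det_updateRow_mul, hP]

theorem spread_bump {d : ℕ} (R : ℝ) (x : Fin d → ℝ) (j : Fin d) (y : ℝ) :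
    spread R (bump x j y) = bump (spread R x) j y := by
  ext k; simp only [spread, bump]; ring

theorem bump_bump {d : ℕ} (x : Fin d → ℝ) (j : Fin d) (u v : ℝ) :
    bump (bump x j u) j v = bump x j (u + v) := by
  ext k; simp only [bump]; split_ifs <;> ring

theorem vandermonde_pos {d : ℕ} {x : Fin d → ℝ} (hx : StrictMono x) : 0 < vandermonde x :=
  Finset.prod_pos fun _ _ => Finset.prod_pos fun _ hj =>
    sub_pos.2 (hx (Finset.mem_Ioi.1 hj))

theorem strictMono_spread {d : ℕ} {R : ℝ} (hR : 0 < R) {x : Fin d → ℝ} (hx : Monotone x) :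
    StrictMono (spread R x) := by
  intro i k hik
  have h1 := hx hik.le
  have h2 : ((i : ℕ) : ℝ) < (k : ℕ) := by exact_mod_cast hik
  simp only [spread]
  nlinarith

theorem vandermonde_le_spread {d : ℕ} {R : ℝ} (hR : 0 ≤ R) {x : Fin d → ℝ} (hx : StrictMono x) :
    vandermonde x ≤ vandermonde (spread R x) := by
  refine Finset.prod_le_prod (fun i _ => Finset.prod_nonneg fun j hj => ?_) fun i _ =>
    Finset.prod_le_prod (fun j hj => ?_) fun j hj => ?_
  · exact (sub_pos.2 (hx (Finset.mem_Ioi.1 hj))).le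
  · exact (sub_pos.2 (hx (Finset.mem_Ioi.1 hj))).le
  · have h2 : ((i : ℕ) : ℝ) ≤ (j : ℕ) := by exact_mod_cast (Finset.mem_Ioi.1 hj).le
    simp only [spread]
    nlinarith

/-- The factor that the pair `(i, k)` contributes when walker `j` is the only one to move and its
pair with walker `l` contributes `w l`. -/
def pairFactor {d : ℕ} (j : Fin d) (w : Fin d → ℝ) (i k : Fin d) : ℝ :=
  if i = j then w k else if k = j then w i else 1

theorem prod_pairFactor {d : ℕ} (j : Fin d) (w : Fin d → ℝ) :
    ∏ i, ∏ k ∈ Finset.Ioi i, pairFactor j w i k = ∏ k ∈ Finset.univ.erase j, w k := by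
  have h : ∀ i, ∏ k ∈ Finset.Ioi i, pairFactor j w i k =
      if i = j then ∏ k ∈ Finset.Ioi j, w k else if i < j then w i else 1 := by
    intro i
    by_cases hij : i = j
    · subst hij
      simp [pairFactor]
    · simp only [pairFactor, hij, if_false]
      rw [Finset.prod_ite_eq']
      simp
  simp_rw [h]
  rw [← Finset.mul_prod_erase _ _ (Finset.mem_univ j), if_pos rfl]
  rw [Finset.prod_congr rfl (g := fun i => if i < j then w i else 1)
    (fun i hi => if_neg (Finset.ne_of_mem_erase hi)), ← Finset.prod_filter]
  have hd : Disjoint (Finset.Ioi j) ((Finset.univ.erase j).filter (· < j)) := by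
    rw [Finset.disjoint_left]
    intro i hi hi'
    exact lt_asymm (Finset.mem_Ioi.1 hi) (Finset.mem_filter.1 hi').2
  rw [← Finset.prod_union hd]
  refine Finset.prod_congr ?_ fun _ _ => rfl
  ext i
  simp only [Finset.mem_union, Finset.mem_Ioi, Finset.mem_filter, Finset.mem_erase,
    Finset.mem_univ, and_true]
  constructor
  · rintro (h | h)
    · exact h.ne'
    · exact h.1
  · intro h
    rcases lt_or_gt_of_ne h with h' | h'
    · exact Or.inr ⟨h, h'⟩
    · exact Or.inl h'

theorem vandermonde_bump_eq {d : ℕ} {b : Fin d → ℝ} (hb : StrictMono b) (j : Fin d) (o : ℝ) :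
    vandermonde (bump b j o) =
      vandermonde b * ∏ k ∈ Finset.univ.erase j, (1 + o / (b j - b k)) := by
  rw [← prod_pairFactor j fun k => 1 + o / (b j - b k), vandermonde, vandermonde,
    ← Finset.prod_mul_distrib]
  refine Finset.prod_congr rfl fun i _ => ?_
  rw [← Finset.prod_mul_distrib]
  refine Finset.prod_congr rfl fun k hk => ?_
  have hik := Finset.mem_Ioi.1 hk
  have hne := hb hik
  simp only [bump, pairFactor]
  by_cases h1 : i = j
  · subst h1
    have : b i - b k ≠ 0 := by linarith
    rw [if_neg hik.ne', if_pos rfl, if_pos rfl]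
    field_simp
    ring
  · by_cases h2 : k = j
    · subst h2
      have : b k - b i ≠ 0 := by linarith
      rw [if_pos rfl, if_neg h1, if_neg h1, if_pos rfl]
      field_simp
      ring
    · simp [h1, h2]

/-- The two sides of `j` are bounded by harmonic numbers. -/
theorem sum_inv_dist_le {d : ℕ} (j : Fin d) :
    ∑ k ∈ Finset.univ.erase j, (1 / |((j : ℕ) : ℝ) - (k : ℕ)|) ≤ 2 * (1 + Real.log d) := by
  have hh : ∀ n : ℕ, n ≤ d → ∑ m ∈ Finset.range n, (1 / ((m : ℝ) + 1)) ≤ 1 + Real.log d := by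
    intro n hn
    calc ∑ m ∈ Finset.range n, (1 / ((m : ℝ) + 1))
        ≤ ∑ m ∈ Finset.range d, (1 / ((m : ℝ) + 1)) :=
          Finset.sum_le_sum_of_subset_of_nonneg (Finset.range_subset_range.2 hn)
            fun _ _ _ => by positivity
      _ = ((harmonic d : ℚ) : ℝ) := by
          simp [harmonic]
      _ ≤ _ := harmonic_le_one_add_log d
  have hsplit : (Finset.univ.erase j : Finset (Fin d)) = Finset.Iio j ∪ Finset.Ioi j := by
    ext i
    simp only [Finset.mem_erase, Finset.mem_univ, and_true, Finset.mem_union, Finset.mem_Iio,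
      Finset.mem_Ioi]
    exact ne_iff_lt_or_gt
  have hd : Disjoint (Finset.Iio j) (Finset.Ioi j) := by
    rw [Finset.disjoint_left]
    intro i hi hi'
    exact lt_asymm (Finset.mem_Iio.1 hi) (Finset.mem_Ioi.1 hi')
  rw [hsplit, Finset.sum_union hd, two_mul]
  refine add_le_add ?_ ?_
  · refine le_trans (le_of_eq ?_) (hh j j.2.le)
    refine Finset.sum_bij' (fun k _ => (j : ℕ) - 1 - k)
      (fun m hm => ⟨(j : ℕ) - 1 - m, by have := j.2; omega⟩) ?_ ?_ ?_ ?_ ?_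
    · intro k hk
      have := Fin.lt_def.1 (Finset.mem_Iio.1 hk)
      simp only [Finset.mem_range]; omega
    · intro m hm
      have := Finset.mem_range.1 hm
      simp only [Finset.mem_Iio, Fin.lt_def]; omega
    · intro k hk
      have := Fin.lt_def.1 (Finset.mem_Iio.1 hk)
      ext; simp only; omega
    · intro m hm
      have := Finset.mem_range.1 hm
      simp only; omega
    · intro k hk
      have := Fin.lt_def.1 (Finset.mem_Iio.1 hk)
      have h3 : ((j : ℕ) : ℝ) - (k : ℕ) = (((j : ℕ) - 1 - (k : ℕ) : ℕ) : ℝ) + 1 := by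
        have : ((j : ℕ) - 1 - (k : ℕ) : ℕ) + 1 + (k : ℕ) = (j : ℕ) := by omega
        have h4 : ((((j : ℕ) - 1 - (k : ℕ) : ℕ) : ℝ) + 1 + (k : ℕ)) = (j : ℕ) := by
          exact_mod_cast this
        linarith
      rw [h3, abs_of_nonneg (by positivity)]
  · refine le_trans (le_of_eq ?_) (hh (d - 1 - j) (by omega))
    refine Finset.sum_bij' (fun k _ => (k : ℕ) - 1 - j)
      (fun m hm => ⟨(j : ℕ) + 1 + m, by have := Finset.mem_range.1 hm; omega⟩) ?_ ?_ ?_ ?_ ?_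
    · intro k hk
      have := Fin.lt_def.1 (Finset.mem_Ioi.1 hk)
      have := k.2
      simp only [Finset.mem_range]; omega
    · intro m hm
      simp only [Finset.mem_Ioi, Fin.lt_def]; omega
    · intro k hk
      have := Fin.lt_def.1 (Finset.mem_Ioi.1 hk)
      ext; simp only; omega
    · intro m hm
      simp only; omega
    · intro k hk
      have := Fin.lt_def.1 (Finset.mem_Ioi.1 hk)
      have h3 : ((k : ℕ) : ℝ) - (j : ℕ) = (((k : ℕ) - 1 - (j : ℕ) : ℕ) : ℝ) + 1 := by
        have : ((k : ℕ) - 1 - (j : ℕ) : ℕ) + 1 + (j : ℕ) = (k : ℕ) := by omega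
        have h4 : ((((k : ℕ) - 1 - (j : ℕ) : ℕ) : ℝ) + 1 + (j : ℕ)) = (k : ℕ) := by
          exact_mod_cast this
        linarith
      rw [abs_sub_comm, h3, abs_of_nonneg (by positivity)]

/-! ### The determinant of a spread configuration -/

theorem abs_spread_sub {d : ℕ} {R : ℝ} (hR : 0 ≤ R) {z : Fin d → ℝ} (hz : Monotone z)
    (j k : Fin d) :
    |spread R z j - spread R z k| = |z j - z k| + R * |((j : ℕ) : ℝ) - (k : ℕ)| := by
  simp only [spread]
  rcases le_total j k with h | h
  · have h1 := hz h
    have h2 : ((j : ℕ) : ℝ) ≤ (k : ℕ) := by exact_mod_cast h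
    rw [abs_of_nonpos (by linarith : z j - z k ≤ 0),
      abs_of_nonpos (by linarith : ((j : ℕ) : ℝ) - (k : ℕ) ≤ 0),
      abs_of_nonpos (by linarith [mul_le_mul_of_nonneg_left h2 hR])]
    ring
  · have h1 := hz h
    have h2 : ((k : ℕ) : ℝ) ≤ (j : ℕ) := by exact_mod_cast h
    rw [abs_of_nonneg (by linarith : 0 ≤ z j - z k),
      abs_of_nonneg (by linarith : 0 ≤ ((j : ℕ) : ℝ) - (k : ℕ)),
      abs_of_nonneg (by linarith [mul_le_mul_of_nonneg_left h2 hR])]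
    ring

theorem le_abs_dist {d : ℕ} {j k : Fin d} (h : k ≠ j) : 1 ≤ |((j : ℕ) : ℝ) - (k : ℕ)| := by
  have : (1 : ℤ) ≤ |((j : ℕ) : ℤ) - (k : ℕ)| := by
    rw [← Int.zero_add 1, Int.add_one_le_iff, abs_pos, sub_ne_zero]
    exact fun h' => h (Fin.ext (by exact_mod_cast h'.symm))
  exact_mod_cast this

/-- The exponential rate at which the spread Vandermonde determinant can change when one walker
moves: the gaps to the other walkers are at least `R, 2R, …` on either side. -/
noncomputable def changeRate (d : ℕ) (R : ℝ) : ℝ := 2 * (1 + Real.log d) / R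

theorem sum_div_spread_le {d : ℕ} {R : ℝ} (hR : 0 < R) {z : Fin d → ℝ} (hz : Monotone z)
    (j : Fin d) (o : ℝ) :
    ∑ k ∈ Finset.univ.erase j, |o| / |spread R z j - spread R z k| ≤ changeRate d R * |o| := by
  have hterm : ∀ k ∈ Finset.univ.erase j, |o| / |spread R z j - spread R z k| ≤
      (|o| / R) * (1 / |((j : ℕ) : ℝ) - (k : ℕ)|) := by
    intro k hk
    have h1 := le_abs_dist (Finset.ne_of_mem_erase hk)
    rw [div_mul_div_comm, mul_one, abs_spread_sub hR.le hz]
    refine div_le_div_of_nonneg_left (abs_nonneg _) (by positivity) ?_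
    linarith [abs_nonneg (z j - z k)]
  refine (Finset.sum_le_sum hterm).trans ?_
  rw [← Finset.mul_sum]
  calc |o| / R * _ ≤ |o| / R * (2 * (1 + Real.log d)) :=
        mul_le_mul_of_nonneg_left (sum_inv_dist_le j) (by positivity)
    _ = _ := by rw [changeRate]; ring

/-- When walker `j` moves by `o` out of the ordered configuration `z`, the spread determinant keeps
a definite part of its value unless `|o|` is large. -/
theorem le_vandermonde_spread_bump {d : ℕ} {R : ℝ} (hR : 0 < R) {z : Fin d → ℝ}
    (hz : Monotone z) (j : Fin d) (o : ℝ) :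
    vandermonde (spread R z) * (2 - Real.exp (changeRate d R * |o|)) ≤
      vandermonde (bump (spread R z) j o) := by
  have hb := strictMono_spread hR hz
  rw [vandermonde_bump_eq hb]
  refine mul_le_mul_of_nonneg_left ?_ (vandermonde_pos hb).le
  have h1 := (Finset.univ.erase j).norm_prod_one_add_sub_one_le
    (fun k => o / (spread R z j - spread R z k))
  have h2 : ∑ k ∈ Finset.univ.erase j, ‖o / (spread R z j - spread R z k)‖ ≤
      changeRate d R * |o| := by
    simpa only [Real.norm_eq_abs, abs_div] using sum_div_spread_le hR hz j o
  have h3 := Real.exp_le_exp.2 h2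
  rw [Real.norm_eq_abs] at h1
  linarith [(abs_le.1 h1).1]

/-- If walkers `j` and `l` are at the same place in the ordered configuration `z` and `j` moves away
by `o`, the determinant is smaller than the spread determinant by a factor of order `|o| / R`. -/
theorem abs_vandermonde_bump_le {d : ℕ} {R : ℝ} (hR : 0 < R) {z : Fin d → ℝ}
    (hz : Monotone z) {j l : Fin d} (hlj : l ≠ j) (hl : z l = z j) (o : ℝ) :
    |vandermonde (bump z j o)| ≤
      vandermonde (spread R z) * (|o| / R * Real.exp (changeRate d R * |o|)) := by
  have hb := strictMono_spread hR hz
  set b := spread R z with hbdef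
  let w : Fin d → ℝ := fun k => if k = l then |o| / R else 1 + |o| / |b j - b k|
  have hw0 : ∀ k, 0 ≤ w k := by
    intro k; simp only [w]; split_ifs <;> positivity
  -- the bound for a pair that involves walker `j`
  have hpair : ∀ k, k ≠ j → |z j - z k + o| ≤ |b j - b k| * w k := by
    intro k hk
    have h1 := le_abs_dist hk
    have h2 := abs_spread_sub hR.le hz j k
    rw [← hbdef] at h2
    by_cases hkl : k = l
    · have hRb : R ≤ |b j - b k| := by nlinarith [abs_nonneg (z j - z k)]
      simp only [w, hkl, if_true]
      rw [hl, sub_self, zero_add]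
      rw [hkl] at hRb
      calc |o| = R * (|o| / R) := by field_simp
        _ ≤ _ := mul_le_mul_of_nonneg_right hRb (by positivity)
    · have hpos : 0 < |b j - b k| := by nlinarith [abs_nonneg (z j - z k)]
      simp only [w, hkl, if_false]
      rw [mul_add, mul_one, mul_div_cancel₀ _ hpos.ne']
      refine (abs_add_le _ _).trans ?_
      nlinarith
  have h1 : |vandermonde (bump z j o)| ≤
      ∏ i, ∏ k ∈ Finset.Ioi i, (b k - b i) * pairFactor j w i k := by
    rw [vandermonde, Finset.abs_prod]
    refine Finset.prod_le_prod (fun i _ => abs_nonneg _) fun i _ => ?_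
    rw [Finset.abs_prod]
    refine Finset.prod_le_prod (fun i _ => abs_nonneg _) fun k hk => ?_
    have hik := Finset.mem_Ioi.1 hk
    have hbik := hb hik
    simp only [bump, pairFactor]
    by_cases h1 : i = j
    · subst h1
      have := hpair k hik.ne'
      rw [if_neg hik.ne', if_pos rfl, if_pos rfl, abs_sub_comm]
      rw [abs_sub_comm (b i), abs_of_pos (by linarith : 0 < b k - b i)] at this
      refine le_trans (le_of_eq (congrArg abs ?_)) this
      ring
    · by_cases h2 : k = j
      · subst h2
        have := hpair i h1
        rw [abs_of_pos (by linarith : 0 < b k - b i)] at this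
        rw [if_pos rfl, if_neg h1, if_neg h1, if_pos rfl]
        refine le_trans (le_of_eq (congrArg abs ?_)) this
        ring
      · simp only [h1, h2, if_false, add_zero, mul_one]
        have h3 := hz hik.le
        rw [abs_of_nonneg (by linarith), hbdef]
        have h4 : ((i : ℕ) : ℝ) ≤ (k : ℕ) := by exact_mod_cast hik.le
        simp only [spread]
        nlinarith
  refine h1.trans ?_
  simp_rw [Finset.prod_mul_distrib]
  rw [prod_pairFactor]
  refine mul_le_mul_of_nonneg_left ?_ (vandermonde_pos hb).le
  have hmem : l ∈ Finset.univ.erase j := Finset.mem_erase.2 ⟨hlj, Finset.mem_univ _⟩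
  rw [← Finset.mul_prod_erase _ _ hmem]
  simp only [w, if_true]
  refine mul_le_mul_of_nonneg_left ?_ (by positivity)
  calc ∏ k ∈ (Finset.univ.erase j).erase l, (if k = l then |o| / R else 1 + |o| / |b j - b k|)
      = ∏ k ∈ (Finset.univ.erase j).erase l, (1 + |o| / |b j - b k|) :=
        Finset.prod_congr rfl fun k hk => if_neg (Finset.ne_of_mem_erase hk)
    _ ≤ Real.exp (∑ k ∈ (Finset.univ.erase j).erase l, |o| / |b j - b k|) :=
        Real.prod_one_add_le_exp_sum _ fun k => by positivity
    _ ≤ Real.exp (changeRate d R * |o|) := by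
        refine Real.exp_le_exp.2 (le_trans ?_ (sum_div_spread_le hR hz j o))
        exact Finset.sum_le_sum_of_subset_of_nonneg (Finset.erase_subset _ _)
          fun _ _ _ => by positivity

/-! ### Overshoots of log-concave laws -/

namespace IsLogConcaveDensity

variable {μ : Measure ℝ} {f : ℝ → ℝ}

/-- The ratio `f (y + h) / f y` of a log-concave function is nonincreasing in `y`. -/
theorem mul_le_mul_shift (hf : IsLogConcaveDensity μ f) {p y h : ℝ} (hpy : p ≤ y) (hh : 0 < h) :
    f p * f (y + h) ≤ f (p + h) * f y := by
  have hD : 0 < y + h - p := by linarith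
  set θ := h / (y + h - p) with hθ
  have hθ0 : 0 ≤ θ := by positivity
  have hθ1 : θ ≤ 1 := (div_le_one hD).2 (by linarith)
  have hθh : θ * (y + h - p) = h := div_mul_cancel₀ _ hD.ne'
  have e1 : (1 - θ) * p + (1 - (1 - θ)) * (y + h) = p + h := by linear_combination hθh
  have e2 : θ * p + (1 - θ) * (y + h) = y := by linear_combination -hθh
  have h1 := hf.logConcave p (y + h) (1 - θ) (by linarith) (by linarith)
  have h2 := hf.logConcave p (y + h) θ hθ0 hθ1
  rw [e1] at h1
  rw [e2] at h2
  have hp : f p ^ (1 - θ) * f p ^ θ = f p := by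
    rw [← Real.rpow_add_of_nonneg (hf.nonneg p) (by linarith) hθ0]; simp
  have hq : f (y + h) ^ (1 - (1 - θ)) * f (y + h) ^ (1 - θ) = f (y + h) := by
    rw [← Real.rpow_add_of_nonneg (hf.nonneg _) (by linarith) (by linarith)]; simp
  have h3 := mul_le_mul h1 h2 (mul_nonneg (Real.rpow_nonneg (hf.nonneg _) _)
    (Real.rpow_nonneg (hf.nonneg _) _)) (hf.nonneg _)
  calc f p * f (y + h) = (f p ^ (1 - θ) * f p ^ θ) *
        (f (y + h) ^ (1 - (1 - θ)) * f (y + h) ^ (1 - θ)) := by rw [hp, hq]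
    _ = _ := by ring
    _ ≤ _ := h3

/-- A function with integral `1` cannot stay above a positive value on a half-line. -/
theorem exists_decrease [IsProbabilityMeasure μ] (hf : IsLogConcaveDensity μ f) :
    ∃ p q, p < q ∧ f q < f p := by
  by_contra! hcon
  have h1 : μ Set.univ = 1 := measure_univ
  rw [hf.density, withDensity_apply _ MeasurableSet.univ, Measure.restrict_univ] at h1
  obtain ⟨p, hp⟩ : ∃ p, 0 < f p := by
    by_contra! h0
    have : ∀ x, ENNReal.ofReal (f x) = 0 := fun x => ENNReal.ofReal_of_nonpos (h0 x)
    simp [this] at h1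
  have h2 : ∫⁻ _ in Set.Ioi p, ENNReal.ofReal (f p) ≤ ∫⁻ x, ENNReal.ofReal (f x) :=
    (setLIntegral_mono' measurableSet_Ioi fun x hx =>
      ENNReal.ofReal_le_ofReal (hcon p x hx)).trans (setLIntegral_le_lintegral _ _)
  rw [h1, setLIntegral_const, Real.volume_Ioi,
    ENNReal.mul_top (ENNReal.ofReal_pos.2 hp).ne'] at h2
  simp at h2

theorem lintegral_shift_le (hf : IsLogConcaveDensity μ f) {p h u : ℝ} (hh : 0 < h) (hp : 0 < f p)
    (hu : p ≤ u) {φ : ℝ → ENNReal} (hφ : Measurable φ) :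
    ∫⁻ y in Set.Ici (u + h), φ y ∂μ ≤
      ENNReal.ofReal (f (p + h) / f p) * ∫⁻ y in Set.Ici u, φ (y + h) ∂μ := by
  have hF : Measurable fun x => ENNReal.ofReal (f x) := hf.measurable.ennreal_ofReal
  have hφh : Measurable fun y => φ (y + h) := hφ.comp (measurable_add_const h)
  rw [hf.density, setLIntegral_withDensity_eq_setLIntegral_mul _ hF hφ measurableSet_Ici,
    setLIntegral_withDensity_eq_setLIntegral_mul _ hF hφh measurableSet_Ici,
    ← lintegral_const_mul _ (hF.mul hφh)]
  have hpre : (fun y : ℝ => y + h) ⁻¹' Set.Ici (u + h) = Set.Ici u := by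
    ext y; simp
  rw [← (measurePreserving_add_right volume h).setLIntegral_comp_preimage measurableSet_Ici
    (hF.mul hφ), hpre]
  refine setLIntegral_mono' measurableSet_Ici fun y hy => ?_
  simp only [Pi.mul_apply]
  rw [← mul_assoc, ← ENNReal.ofReal_mul (div_nonneg (hf.nonneg _) hp.le)]
  gcongr
  have := hf.mul_le_mul_shift (hu.trans hy) hh
  rw [div_mul_eq_mul_div, le_div_iff₀ hp]
  linarith

/-- A log-concave density decays at least geometrically, so the excess over a level `u ≥ 0`, given
that the level is exceeded, has an exponential moment bounded uniformly in `u`. -/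
theorem exists_excess_bound [IsProbabilityMeasure μ] (hf : IsLogConcaveDensity μ f)
    {δ₀ : ℝ} (hδ₀ : 0 < δ₀)
    (hexp : ∀ δ, -δ₀ < δ → δ < δ₀ → Integrable (fun y => Real.exp (δ * y)) μ) :
    ∃ r M : ℝ, 0 < r ∧ 0 < M ∧ ∀ u, 0 ≤ u →
      ∫⁻ y in Set.Ici u, ENNReal.ofReal (Real.exp (r * (y - u))) ∂μ ≤
        ENNReal.ofReal M * μ (Set.Ici u) := by
  obtain ⟨p, q, hpq, hfq⟩ := hf.exists_decrease
  have hp : 0 < f p := (hf.nonneg q).trans_lt hfq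
  obtain ⟨h, rfl⟩ : ∃ h, q = p + h := ⟨q - p, by ring⟩
  have hh : 0 < h := by linarith
  set ρ := f (p + h) / f p with hρ
  have hρ0 : 0 ≤ ρ := div_nonneg (hf.nonneg _) hp.le
  have hρ1 : ρ < 1 := (div_lt_one hp).2 hfq
  -- the rate is small enough that one step of length `h` still contracts
  obtain ⟨r, ⟨hr1, hrδ⟩, hr0⟩ : ∃ r : ℝ, (Real.exp (r * h) * ρ < 1 ∧ r < δ₀) ∧ 0 < r := by
    have hc : Tendsto (fun r : ℝ => Real.exp (r * h) * ρ) (𝓝[>] 0)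
        (𝓝 (Real.exp (0 * h) * ρ)) :=
      ((by fun_prop : Continuous fun r : ℝ => Real.exp (r * h) * ρ).tendsto 0).mono_left
        nhdsWithin_le_nhds
    have e1 : ∀ᶠ r in 𝓝[>] (0 : ℝ), Real.exp (r * h) * ρ < 1 :=
      hc.eventually (gt_mem_nhds (by simpa using hρ1))
    have e2 : ∀ᶠ r in 𝓝[>] (0 : ℝ), r < δ₀ :=
      nhdsWithin_le_nhds (gt_mem_nhds hδ₀)
    exact ((e1.and e2).and self_mem_nhdsWithin).exists
  set s := Real.exp (r * h) * ρ with hs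
  have hs0 : 0 ≤ s := by positivity
  let J : ℝ → ENNReal := fun u => ∫⁻ y in Set.Ici u, ENNReal.ofReal (Real.exp (r * (y - u))) ∂μ
  have hmeas : ∀ u, Measurable fun y : ℝ => ENNReal.ofReal (Real.exp (r * (y - u))) := by
    intro u; fun_prop
  have hJfin : ∀ u, J u ≠ ⊤ := by
    intro u
    have h1 : Integrable (fun y => Real.exp (r * (y - u))) μ := by
      have := (hexp r (by linarith) hrδ).mul_const (Real.exp (-(r * u)))
      refine this.congr (ae_of_all _ fun y => ?_)
      simp only
      rw [← Real.exp_add]; ring_nf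
    refine ((setLIntegral_le_lintegral _ _).trans_lt ?_).ne
    rw [← ofReal_integral_eq_lintegral_ofReal h1 (ae_of_all _ fun _ => (Real.exp_pos _).le)]
    exact ENNReal.ofReal_lt_top
  have hsplit : ∀ u v, u ≤ v → J u =
      ∫⁻ y in Set.Ico u v, ENNReal.ofReal (Real.exp (r * (y - u))) ∂μ +
      ∫⁻ y in Set.Ici v, ENNReal.ofReal (Real.exp (r * (y - u))) ∂μ := by
    intro u v huv
    rw [← lintegral_union measurableSet_Ici]
    · rw [Set.Ico_union_Ici_eq_Ici huv]
    · rw [Set.disjoint_left]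
      intro y hy hy'
      exact absurd hy.2 (not_lt.2 hy')
  have hIco : ∀ u v, u ≤ v →
      ∫⁻ y in Set.Ico u v, ENNReal.ofReal (Real.exp (r * (y - u))) ∂μ ≤
      ENNReal.ofReal (Real.exp (r * (v - u))) * μ (Set.Ici u) := by
    intro u v _
    refine (setLIntegral_mono' measurableSet_Ico
      (g := fun _ => ENNReal.ofReal (Real.exp (r * (v - u)))) fun y hy =>
        ENNReal.ofReal_le_ofReal (Real.exp_le_exp.2 ?_)).trans ?_
    · have := hy.2
      nlinarith
    · rw [setLIntegral_const]
      gcongr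
      exact Set.Ico_subset_Ici_self
  set M₁ := Real.exp (r * h) / (1 - s) with hM₁
  have hM₁0 : 0 < M₁ := div_pos (Real.exp_pos _) (by linarith)
  have hfar : ∀ u, p ≤ u → J u ≤ ENNReal.ofReal M₁ * μ (Set.Ici u) := by
    intro u hu
    have h1 : J u ≤ ENNReal.ofReal (Real.exp (r * h)) * μ (Set.Ici u) +
        ENNReal.ofReal s * J u := by
      rw [hsplit u (u + h) (by linarith)]
      refine add_le_add ?_ ?_
      · simpa using hIco u (u + h) (by linarith)
      · refine (hf.lintegral_shift_le hh hp hu (hmeas u)).trans (le_of_eq ?_)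
        rw [hs, mul_comm (Real.exp _), ENNReal.ofReal_mul hρ0, mul_assoc,
          ← hsplit u (u + h) (by linarith), ← lintegral_const_mul _ (hmeas u)]
        congr 2
        ext y
        rw [← ENNReal.ofReal_mul (Real.exp_pos _).le, ← Real.exp_add]
        ring_nf
    have hG : μ (Set.Ici u) ≠ ⊤ := measure_ne_top _ _
    rw [← ENNReal.ofReal_toReal (hJfin u), ← ENNReal.ofReal_toReal hG] at h1 ⊢
    rw [← ENNReal.ofReal_mul (Real.exp_pos _).le, ← ENNReal.ofReal_mul hs0,
      ← ENNReal.ofReal_add (by positivity) (by positivity),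
      ENNReal.ofReal_le_ofReal_iff (by positivity)] at h1
    rw [← ENNReal.ofReal_mul hM₁0.le]
    refine ENNReal.ofReal_le_ofReal ?_
    rw [hM₁, div_mul_eq_mul_div, le_div_iff₀ (by linarith)]
    linarith
  refine ⟨r, Real.exp (r * |p|) * (1 + M₁), hr0, by positivity, fun u hu => ?_⟩
  have hE : 1 ≤ Real.exp (r * |p|) := Real.one_le_exp (by positivity)
  rcases le_total p u with hpu | hup
  · refine (hfar u hpu).trans ?_
    gcongr
    nlinarith
  · change J u ≤ _
    have hpu : r * (p - u) ≤ r * |p| :=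
      mul_le_mul_of_nonneg_left (by linarith [le_abs_self p]) hr0.le
    rw [hsplit u p hup, mul_add, mul_one, ENNReal.ofReal_add (by positivity) (by positivity),
      add_mul]
    refine add_le_add ((hIco u p hup).trans ?_) ?_
    · gcongr
    · calc ∫⁻ y in Set.Ici p, ENNReal.ofReal (Real.exp (r * (y - u))) ∂μ
          = ENNReal.ofReal (Real.exp (r * (p - u))) * J p := by
            rw [← lintegral_const_mul _ (hmeas p)]
            congr 1
            ext y
            rw [← ENNReal.ofReal_mul (Real.exp_pos _).le, ← Real.exp_add]
            ring_nf
        _ ≤ ENNReal.ofReal (Real.exp (r * |p|)) *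
            (ENNReal.ofReal M₁ * μ (Set.Ici u)) := by
            gcongr
            refine (hfar p le_rfl).trans ?_
            gcongr
        _ = _ := by rw [ENNReal.ofReal_mul (Real.exp_pos _).le, mul_assoc]

/-- The law of `-y` has the reflected density. -/
theorem reflect (hf : IsLogConcaveDensity μ f) :
    IsLogConcaveDensity (μ.map fun y => -y) fun y => f (-y) where
  measurable := hf.measurable.comp measurable_neg
  nonneg x := hf.nonneg _
  density := by
    ext s hs
    rw [Measure.map_apply measurable_neg hs, hf.density,
      withDensity_apply _ (measurable_neg hs), withDensity_apply _ hs]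
    have := (Measure.measurePreserving_neg (volume : Measure ℝ)).setLIntegral_comp_preimage hs
      (f := fun y => ENNReal.ofReal (f (-y)))
      (hf.measurable.comp measurable_neg).ennreal_ofReal
    simpa using this
  logConcave x y θ h0 h1 := by
    have := hf.logConcave (-x) (-y) θ h0 h1
    convert this using 2
    ring

end IsLogConcaveDensity

/-! ### Exit from the chamber in one jump -/

theorem monotone_bump {d : ℕ} {x : Fin d → ℝ} (hx : StrictMono x) {j : Fin d} {u : ℝ}
    (h1 : ∀ i < j, x i ≤ x j + u) (h2 : ∀ k > j, x j + u ≤ x k) : Monotone (bump x j u) := by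
  refine monotone_iff_forall_lt.2 fun i k hik => ?_
  simp only [bump]
  by_cases hi : i = j
  · subst hi
    simpa [hik.ne'] using h2 k hik
  · by_cases hk : k = j
    · subst hk
      simpa [hi] using h1 i hik
    · simpa [hi, hk] using (hx hik).le

theorem strictMono_bump_iff {d : ℕ} {x : Fin d → ℝ} (hx : StrictMono x) {j : Fin d} {u : ℝ} :
    StrictMono (bump x j u) ↔ (∀ i < j, x i < x j + u) ∧ ∀ k > j, x j + u < x k := by
  constructor
  · refine fun h => ⟨fun i hi => ?_, fun k hk => ?_⟩
    · simpa [bump, hi.ne] using h hi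
    · simpa [bump, hk.ne'] using h hk
  · rintro ⟨h1, h2⟩ i k hik
    simp only [bump]
    by_cases hi : i = j
    · subst hi
      simpa [hik.ne'] using h2 k hik
    · by_cases hk : k = j
      · subst hk
        simpa [hi] using h1 i hik
      · simpa [hi, hk] using hx hik

/-- The jumps by which walker `j` reaches or passes its upper neighbour. -/
def upExit {d : ℕ} (x : Fin d → ℝ) (j : Fin d) : Set ℝ := {y | ∃ k > j, x k ≤ x j + y}

/-- The jumps by which walker `j` reaches or passes its lower neighbour. -/
def downExit {d : ℕ} (x : Fin d → ℝ) (j : Fin d) : Set ℝ := {y | ∃ i < j, x j + y ≤ x i}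

theorem upExit_eq {d : ℕ} {x : Fin d → ℝ} (hx : StrictMono x) (j : Fin d) :
    upExit x j = ∅ ∨ ∃ l, l ≠ j ∧ 0 < x l - x j ∧ upExit x j = Set.Ici (x l - x j) ∧
      Monotone (bump x j (x l - x j)) := by
  by_cases h : (j : ℕ) + 1 < d
  · right
    let l : Fin d := ⟨j + 1, h⟩
    have hjl : j < l := Fin.lt_def.2 (Nat.lt_succ_self _)
    have hl : ∀ k, j < k → l ≤ k := fun k hk => Fin.le_def.2 (Fin.lt_def.1 hk)
    refine ⟨l, hjl.ne', sub_pos.2 (hx hjl), ?_, monotone_bump hx (fun i hi => ?_) fun k hk => ?_⟩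
    · ext y
      simp only [upExit, Set.mem_ofPred_eq, Set.mem_Ici]
      constructor
      · rintro ⟨k, hk, hy⟩
        have := hx.monotone (hl k hk)
        linarith
      · exact fun hy => ⟨l, hjl, by linarith⟩
    · have := hx (hi.trans hjl); linarith
    · have := hx.monotone (hl k hk); linarith
  · left
    refine Set.eq_empty_of_forall_notMem fun y => ?_
    rintro ⟨k, hk, -⟩
    have := Fin.lt_def.1 hk
    omega

theorem downExit_eq {d : ℕ} {x : Fin d → ℝ} (hx : StrictMono x) (j : Fin d) :
    downExit x j = ∅ ∨ ∃ l, l ≠ j ∧ 0 < x j - x l ∧ downExit x j = Set.Iic (-(x j - x l)) ∧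
      Monotone (bump x j (x l - x j)) := by
  by_cases h : 0 < (j : ℕ)
  · right
    let l : Fin d := ⟨j - 1, by omega⟩
    have hjl : l < j := Fin.lt_def.2 (Nat.sub_lt h one_pos)
    have hl : ∀ k, k < j → k ≤ l := fun k hk =>
      Fin.le_def.2 (Nat.le_sub_one_of_lt (Fin.lt_def.1 hk))
    refine ⟨l, hjl.ne, sub_pos.2 (hx hjl), ?_, monotone_bump hx (fun i hi => ?_) fun k hk => ?_⟩
    · ext y
      simp only [downExit, Set.mem_ofPred_eq, Set.mem_Iic]
      constructor
      · rintro ⟨k, hk, hy⟩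
        have := hx.monotone (hl k hk)
        linarith
      · exact fun hy => ⟨l, hjl, by linarith⟩
    · have := hx.monotone (hl i hi); linarith
    · have := hx (hjl.trans hk); linarith
  · left
    refine Set.eq_empty_of_forall_notMem fun y => ?_
    rintro ⟨k, hk, -⟩
    have := Fin.lt_def.1 hk
    omega

/-- The excess over a level has an exponential moment of order `r`, bounded by `M` uniformly over
the levels, upwards and downwards. -/
structure ExcessBound (μ : Measure ℝ) (r M : ℝ) : Prop where
  rate_pos : 0 < r
  const_pos : 0 < M
  up : ∀ u, 0 ≤ u → ∫⁻ y in Set.Ici u, ENNReal.ofReal (Real.exp (r * |y - u|)) ∂μ ≤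
    ENNReal.ofReal M * μ (Set.Ici u)
  down : ∀ u, 0 ≤ u → ∫⁻ y in Set.Iic (-u), ENNReal.ofReal (Real.exp (r * |y - -u|)) ∂μ ≤
    ENNReal.ofReal M * μ (Set.Iic (-u))

theorem IsLogConcaveDensity.exists_excessBound {μ : Measure ℝ} {f : ℝ → ℝ}
    [IsProbabilityMeasure μ] (hf : IsLogConcaveDensity μ f) {δ₀ : ℝ} (hδ₀ : 0 < δ₀)
    (hexp : ∀ δ, -δ₀ < δ → δ < δ₀ → Integrable (fun y => Real.exp (δ * y)) μ) :
    ∃ r M, ExcessBound μ r M := by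
  obtain ⟨r₁, M₁, hr₁, hM₁, h₁⟩ := hf.exists_excess_bound hδ₀ hexp
  have : IsProbabilityMeasure (μ.map fun y => -y) :=
    Measure.isProbabilityMeasure_map measurable_neg.aemeasurable
  have hexp' : ∀ δ, -δ₀ < δ → δ < δ₀ →
      Integrable (fun y => Real.exp (δ * y)) (μ.map fun y => -y) := by
    intro δ h1 h2
    rw [integrable_map_measure (by fun_prop) (by fun_prop)]
    refine (hexp (-δ) (by linarith) (by linarith)).congr (ae_of_all _ fun y => ?_)
    simp
  obtain ⟨r₂, M₂, hr₂, hM₂, h₂⟩ := hf.reflect.exists_excess_bound hδ₀ hexp'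
  refine ⟨min r₁ r₂, max M₁ M₂, lt_min hr₁ hr₂, lt_max_of_lt_left hM₁, fun u hu => ?_,
    fun u hu => ?_⟩
  · calc _ ≤ ∫⁻ y in Set.Ici u, ENNReal.ofReal (Real.exp (r₁ * (y - u))) ∂μ := by
          refine setLIntegral_mono' measurableSet_Ici fun y hy => ?_
          have h : 0 ≤ y - u := sub_nonneg.2 hy
          rw [abs_of_nonneg h]
          gcongr
          exact min_le_left _ _
      _ ≤ _ := h₁ u hu
      _ ≤ _ := by gcongr; exact le_max_left _ _
  · have h := h₂ u hu
    have hpre : (fun y : ℝ => -y) ⁻¹' Set.Ici u = Set.Iic (-u) := by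
      ext y; simp
    rw [Measure.map_apply measurable_neg measurableSet_Ici,
      setLIntegral_map measurableSet_Ici (by fun_prop) measurable_neg, hpre] at h
    calc _ ≤ ∫⁻ y in Set.Iic (-u), ENNReal.ofReal (Real.exp (r₂ * (-y - u))) ∂μ := by
          refine setLIntegral_mono' measurableSet_Iic fun y hy => ?_
          have h : 0 ≤ -y - u := by have := Set.mem_Iic.1 hy; linarith
          have h3 : |y - -u| = -y - u := by rw [abs_of_nonpos (by linarith)]; ring
          rw [h3]
          gcongr
          exact min_le_right _ _
      _ ≤ _ := h
      _ ≤ _ := by gcongr; exact le_max_right _ _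

theorem mul_exp_le {r θ t : ℝ} (hr : 0 < r) (hθ : θ ≤ r / 2) (ht : 0 ≤ t) :
    t * Real.exp (θ * t) ≤ 2 / r * Real.exp (r * t) := by
  have h1 : r / 2 * t ≤ Real.exp (r / 2 * t) :=
    (le_add_of_nonneg_right zero_le_one).trans (Real.add_one_le_exp _)
  have h2 : Real.exp (θ * t) ≤ Real.exp (r / 2 * t) :=
    Real.exp_le_exp.2 (mul_le_mul_of_nonneg_right hθ ht)
  calc t * Real.exp (θ * t) = 2 / r * ((r / 2 * t) * Real.exp (θ * t)) := by field_simp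
    _ ≤ 2 / r * (Real.exp (r / 2 * t) * Real.exp (r / 2 * t)) := by gcongr
    _ = _ := by rw [← Real.exp_add]; ring_nf

/-- Conditionally on a jump that makes walker `j` leave the chamber on one side, with excess
`y - c`, the determinant is on average smaller than the spread determinant by a factor of
order `1 / R`. -/
theorem setIntegral_abs_vandermonde_le {μ : Measure ℝ} [IsProbabilityMeasure μ] {r M : ℝ}
    (hr : 0 < r) (hM : 0 < M) {U : Set ℝ} (hU : MeasurableSet U) {c : ℝ}
    (hexc : ∫⁻ y in U, ENNReal.ofReal (Real.exp (r * |y - c|)) ∂μ ≤ ENNReal.ofReal M * μ U)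
    {d : ℕ} {R : ℝ} (hR : 0 < R) (hθ : changeRate d R ≤ r / 2)
    (hθM : changeRate d R * M ≤ r / 4) {z : Fin d → ℝ} (hz : Monotone z) {j l : Fin d}
    (hlj : l ≠ j) (hl : z l = z j)
    (hint : IntegrableOn (fun y => vandermonde (bump z j (y - c))) U μ)
    (hintR : IntegrableOn (fun y => vandermonde (bump (spread R z) j (y - c))) U μ) :
    ∫ y in U, |vandermonde (bump z j (y - c))| ∂μ ≤
      4 * M / (r * R) * ∫ y in U, vandermonde (bump (spread R z) j (y - c)) ∂μ := by
  set B := vandermonde (spread R z) with hB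
  have hB0 : 0 < B := vandermonde_pos (strictMono_spread hR hz)
  set θ := changeRate d R with hθdef
  have hd : 1 ≤ d := Nat.succ_le_of_lt (Nat.zero_lt_of_lt j.2)
  have hθ0 : 0 ≤ θ := by
    have : 0 ≤ Real.log d := Real.log_nonneg (by exact_mod_cast hd)
    rw [hθdef, changeRate]; positivity
  have hE : IntegrableOn (fun y => Real.exp (r * |y - c|)) U μ := by
    refine ⟨by fun_prop, ?_⟩
    rw [hasFiniteIntegral_iff_ofReal (ae_of_all _ fun _ => (Real.exp_pos _).le)]
    exact hexc.trans_lt (ENNReal.mul_lt_top ENNReal.ofReal_lt_top (measure_lt_top _ _))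
  have hEM : ∫ y in U, Real.exp (r * |y - c|) ∂μ ≤ M * μ.real U := by
    rw [integral_eq_lintegral_of_nonneg_ae (ae_of_all _ fun _ => (Real.exp_pos _).le)
      (by fun_prop)]
    refine (ENNReal.toReal_mono (ENNReal.mul_ne_top ENNReal.ofReal_ne_top
      (measure_ne_top _ _)) hexc).trans ?_
    rw [ENNReal.toReal_mul, ENNReal.toReal_ofReal hM.le]; rfl
  have h1 : ∫ y in U, |vandermonde (bump z j (y - c))| ∂μ ≤
      B * (2 / (r * R)) * ∫ y in U, Real.exp (r * |y - c|) ∂μ := by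
    rw [← integral_const_mul]
    refine setIntegral_mono_on hint.abs (hE.const_mul _) hU fun y _ => ?_
    refine (abs_vandermonde_bump_le hR hz hlj hl _).trans ?_
    have := mul_exp_le hr hθ (abs_nonneg (y - c))
    calc B * (|y - c| / R * Real.exp (θ * |y - c|))
        = B / R * (|y - c| * Real.exp (θ * |y - c|)) := by ring
      _ ≤ B / R * (2 / r * Real.exp (r * |y - c|)) := by gcongr
      _ = _ := by field_simp
  have h2 : B * (μ.real U - θ * (2 / r) * ∫ y in U, Real.exp (r * |y - c|) ∂μ) ≤
      ∫ y in U, vandermonde (bump (spread R z) j (y - c)) ∂μ := by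
    have h3 : B * (μ.real U - θ * (2 / r) * ∫ y in U, Real.exp (r * |y - c|) ∂μ) =
        ∫ y in U, B * (1 - θ * (2 / r) * Real.exp (r * |y - c|)) ∂μ := by
      rw [integral_const_mul, integral_sub (integrable_const _).integrableOn (hE.const_mul _),
        integral_const_mul, setIntegral_const, smul_eq_mul, mul_one]
    rw [h3]
    refine setIntegral_mono_on (((integrable_const _).integrableOn.sub
      (hE.const_mul _)).const_mul _) hintR hU fun y _ => ?_
    refine le_trans ?_ (le_vandermonde_spread_bump hR hz j _)
    refine mul_le_mul_of_nonneg_left ?_ hB0.le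
    have h4 := mul_exp_le hr hθ (abs_nonneg (y - c))
    have h5 : Real.exp (θ * |y - c|) - 1 ≤ θ * |y - c| * Real.exp (θ * |y - c|) := by
      have h6 := Real.one_sub_le_exp_neg (θ * |y - c|)
      have h7 : Real.exp (-(θ * |y - c|)) * Real.exp (θ * |y - c|) = 1 := by
        rw [← Real.exp_add]; simp
      nlinarith [Real.exp_pos (θ * |y - c|)]
    have h8 := mul_le_mul_of_nonneg_left h4 hθ0
    nlinarith
  set I := ∫ y in U, Real.exp (r * |y - c|) ∂μ
  have hm : 0 ≤ μ.real U := measureReal_nonneg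
  have h3 : θ * (2 / r) * I ≤ μ.real U / 2 := by
    calc θ * (2 / r) * I ≤ θ * (2 / r) * (M * μ.real U) := by gcongr
      _ = (θ * M) * (2 / r * μ.real U) := by ring
      _ ≤ (r / 4) * (2 / r * μ.real U) := by gcongr
      _ = _ := by field_simp; ring
  calc _ ≤ B * (2 / (r * R)) * I := h1
    _ ≤ B * (2 / (r * R)) * (M * μ.real U) := by gcongr
    _ = 4 * M / (r * R) * (B * (μ.real U / 2)) := by ring
    _ ≤ 4 * M / (r * R) * (B * (μ.real U - θ * (2 / r) * I)) := by
        gcongr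
        linarith
    _ ≤ _ := by gcongr

/-- The Vandermonde determinant, as a function of the position of one walker, is a polynomial. -/
theorem integrable_vandermonde_bump {μ : Measure ℝ}
    (hmom : ∀ n : ℕ, Integrable (fun y : ℝ => y ^ n) μ) {d : ℕ} (x : Fin d → ℝ) (j : Fin d) :
    Integrable (fun y => vandermonde (bump x j y)) μ := by
  let p : Polynomial ℝ := ∏ i : Fin d, ∏ k ∈ Finset.Ioi i,
    ((Polynomial.C (x k) + if k = j then Polynomial.X else 0) -
      (Polynomial.C (x i) + if i = j then Polynomial.X else 0))
  have hp : (fun y => vandermonde (bump x j y)) = fun y => p.eval y := by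
    ext y
    simp only [p, Polynomial.eval_prod, vandermonde, bump]
    refine Finset.prod_congr rfl fun i _ => Finset.prod_congr rfl fun k _ => ?_
    split_ifs <;> simp
  rw [hp]
  simp_rw [Polynomial.eval_eq_sum_range]
  exact integrable_finsetSum _ fun n _ => (hmom n).const_mul _

theorem measurableSet_weylChamber (d : ℕ) : MeasurableSet (weylChamber d) := by
  have : weylChamber d = ⋂ (i : Fin d) (k : Fin d) (_ : i < k), {x : Fin d → ℝ | x i < x k} := by
    ext x
    simp [weylChamber, StrictMono]
  rw [this]
  exact MeasurableSet.iInter fun i => MeasurableSet.iInter fun k => MeasurableSet.iInter fun _ =>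
    measurableSet_lt (measurable_pi_apply i) (measurable_pi_apply k)

theorem measurable_bump {d : ℕ} (x : Fin d → ℝ) (j : Fin d) : Measurable (bump x j) := by
  refine measurable_pi_iff.2 fun k => ?_
  simp only [bump]
  split_ifs <;> fun_prop

theorem measurable_vandermonde {d : ℕ} : Measurable (vandermonde : (Fin d → ℝ) → ℝ) := by
  unfold vandermonde
  fun_prop

theorem measurable_spread {d : ℕ} (R : ℝ) :
    Measurable (spread R : (Fin d → ℝ) → (Fin d → ℝ)) := by
  unfold spread
  fun_prop

/-- The part of the determinant that is lost at the exit from the chamber is, in absolute value, at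
most a fraction of order `1 / R` of the spread determinant at that moment. -/
theorem setIntegral_exit_le {μ : Measure ℝ} [IsProbabilityMeasure μ] {r M : ℝ}
    (hexc : ExcessBound μ r M) (hmom : ∀ n : ℕ, Integrable (fun y : ℝ => y ^ n) μ)
    {d : ℕ} {R : ℝ} (hR : 0 < R) (hθ : changeRate d R ≤ r / 2)
    (hθM : changeRate d R * M ≤ r / 4) {x : Fin d → ℝ} (hx : StrictMono x) (j : Fin d) :
    ∫ y in {y | bump x j y ∉ weylChamber d}, |vandermonde (bump x j y)| ∂μ ≤
      4 * M / (r * R) *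
        ∫ y in {y | bump x j y ∉ weylChamber d}, vandermonde (bump (spread R x) j y) ∂μ := by
  have hset : {y | bump x j y ∉ weylChamber d} = upExit x j ∪ downExit x j := by
    ext y
    simp only [weylChamber, Set.mem_ofPred_eq, strictMono_bump_iff hx, upExit, downExit,
      Set.mem_union, not_and_or]
    push Not
    exact or_comm
  have hi := integrable_vandermonde_bump hmom x j
  have hiR := integrable_vandermonde_bump hmom (spread R x) j
  -- one side of the exit set, a half-line that starts at `c`
  have hside : ∀ (U : Set ℝ) (c : ℝ) (l : Fin d), MeasurableSet U →
      ∫⁻ y in U, ENNReal.ofReal (Real.exp (r * |y - c|)) ∂μ ≤ ENNReal.ofReal M * μ U →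
      l ≠ j → c = x l - x j → Monotone (bump x j c) →
      ∫ y in U, |vandermonde (bump x j y)| ∂μ ≤
        4 * M / (r * R) * ∫ y in U, vandermonde (bump (spread R x) j y) ∂μ := by
    intro U c l hU hb hlj hc hmono
    have e1 : ∀ y, bump (bump x j c) j (y - c) = bump x j y := fun y => by
      rw [bump_bump]; congr 1; ring
    have e2 : ∀ y, bump (spread R (bump x j c)) j (y - c) = bump (spread R x) j y := fun y => by
      rw [spread_bump, bump_bump]; congr 1; ring
    have := setIntegral_abs_vandermonde_le hexc.rate_pos hexc.const_pos hU hb hR hθ hθM hmono hlj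
      (by simp [bump, hlj, hc]) (by simpa only [e1] using hi.integrableOn)
      (by simpa only [e2] using hiR.integrableOn)
    simpa only [e1, e2] using this
  have hup : MeasurableSet (upExit x j) ∧
      ∫ y in upExit x j, |vandermonde (bump x j y)| ∂μ ≤
        4 * M / (r * R) * ∫ y in upExit x j, vandermonde (bump (spread R x) j y) ∂μ := by
    rcases upExit_eq hx j with h | ⟨l, hlj, hpos, h, hmono⟩
    · simp [h]
    · rw [h]
      exact ⟨measurableSet_Ici, hside _ _ l measurableSet_Ici (hexc.up _ hpos.le) hlj rfl hmono⟩
  have hdown : MeasurableSet (downExit x j) ∧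
      ∫ y in downExit x j, |vandermonde (bump x j y)| ∂μ ≤
        4 * M / (r * R) * ∫ y in downExit x j, vandermonde (bump (spread R x) j y) ∂μ := by
    rcases downExit_eq hx j with h | ⟨l, hlj, hpos, h, hmono⟩
    · simp [h]
    · rw [h]
      refine ⟨measurableSet_Iic, hside _ _ l measurableSet_Iic (hexc.down _ hpos.le) hlj
        (by ring) ?_⟩
      rwa [neg_sub]
  have hdisj : Disjoint (upExit x j) (downExit x j) := by
    rw [Set.disjoint_left]
    rintro y ⟨k, hk, hy⟩ ⟨i, hi, hy'⟩
    have := hx (hi.trans hk)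
    linarith
  rw [hset, setIntegral_union hdisj hdown.1 hi.abs.integrableOn hi.abs.integrableOn,
    setIntegral_union hdisj hdown.1 hiR.integrableOn hiR.integrableOn, mul_add]
  exact add_le_add hup.2 hdown.2

/-- One step of the killed walk moves the determinant by at most a fraction of order `1 / R` of what
it takes away from the spread determinant. -/
theorem abs_sum_setIntegral_sub_le {μ : Measure ℝ} [IsProbabilityMeasure μ] {r M : ℝ}
    (hexc : ExcessBound μ r M) (hmom : ∀ n : ℕ, Integrable (fun y : ℝ => y ^ n) μ)
    {d : ℕ} {R : ℝ} (hR : 0 < R) (hθ : changeRate d R ≤ r / 2)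
    (hθM : changeRate d R * M ≤ r / 4) {x : Fin d → ℝ} (hx : StrictMono x) :
    |∑ j, ∫ y in {y | bump x j y ∈ weylChamber d}, vandermonde (bump x j y) ∂μ
        - d * vandermonde x| ≤
      4 * M / (r * R) * (d * vandermonde (spread R x) -
        ∑ j, ∫ y in {y | bump x j y ∈ weylChamber d}, vandermonde (bump (spread R x) j y) ∂μ) := by
  -- by harmonicity, what is missing from the part inside the chamber is the part outside
  have key : ∀ z : Fin d → ℝ,
      d * vandermonde z - ∑ j, ∫ y in {y | bump x j y ∈ weylChamber d}, vandermonde (bump z j y) ∂μ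
      = ∑ j, ∫ y in {y | bump x j y ∉ weylChamber d}, vandermonde (bump z j y) ∂μ := by
    intro z
    have h1 : (d : ℝ) * vandermonde z = ∑ j, ∫ y, vandermonde (bump z j y) ∂μ := by
      rw [← integral_finsetSum _ fun j _ => integrable_vandermonde_bump hmom z j]
      simp_rw [sum_vandermonde_bump]
      simp
    rw [h1, ← Finset.sum_sub_distrib]
    refine Finset.sum_congr rfl fun j _ => ?_
    rw [← integral_add_compl (measurable_bump x j (measurableSet_weylChamber d))
      (integrable_vandermonde_bump hmom z j)]
    exact add_sub_cancel_left _ _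
  rw [abs_sub_comm, key x, key (spread R x), Finset.mul_sum]
  refine (Finset.abs_sum_le_sum_abs _ _).trans (Finset.sum_le_sum fun j _ => ?_)
  exact (abs_integral_le_integral_abs).trans (setIntegral_exit_le hexc hmom hR hθ hθM hx j)

/-! ### The killed jump chain -/

/-- The sum over the walkers `j` of the expected value of `g` after a jump of walker `j` from `x`,
killed if `x ∉ D`. Up to the factor `1 / d` this is one step of the jump chain killed outside
`D`. -/
noncomputable def killedStep (μ : Measure ℝ) {d : ℕ} (D : Set (Fin d → ℝ))
    (g : (Fin d → ℝ) → ℝ≥0∞) : (Fin d → ℝ) → ℝ≥0∞ :=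
  D.indicator fun x => ∑ j, ∫⁻ y, g (bump x j y) ∂μ

/-- The sum over all words of `n` walkers of the expected value of `H` after these walkers have
jumped one after the other from `x`, on the event that no position leaves `D`. It is `d ^ n` times the
`n`-step expectation of `H` under the killed jump chain. -/
noncomputable def killedIter (μ : Measure ℝ) {d : ℕ} (D : Set (Fin d → ℝ))
    (H : (Fin d → ℝ) → ℝ≥0∞) : ℕ → (Fin d → ℝ) → ℝ≥0∞
  | 0 => D.indicator H
  | n + 1 => killedStep μ D (killedIter μ D H n)

section KilledStep

variable {μ : Measure ℝ} {d : ℕ} {D : Set (Fin d → ℝ)}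
  {g h H : (Fin d → ℝ) → ℝ≥0∞}

theorem killedStep_of_mem {x : Fin d → ℝ} (hx : x ∈ D) :
    killedStep μ D g x = ∑ j, ∫⁻ y, g (bump x j y) ∂μ := Set.indicator_of_mem hx _

theorem killedStep_of_notMem {x : Fin d → ℝ} (hx : x ∉ D) : killedStep μ D g x = 0 :=
  Set.indicator_of_notMem hx _

theorem measurable_bump_prod {d : ℕ} (j : Fin d) :
    Measurable fun p : (Fin d → ℝ) × ℝ => bump p.1 j p.2 := by
  refine measurable_pi_iff.2 fun k => ?_
  simp only [bump]
  split_ifs <;> fun_prop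

theorem measurable_killedStep [SFinite μ] (hD : MeasurableSet D) (hg : Measurable g) :
    Measurable (killedStep μ D g) := by
  refine Measurable.indicator ?_ hD
  exact Finset.measurable_fun_sum _ fun j _ =>
    (hg.comp (measurable_bump_prod j)).lintegral_prod_right'

theorem measurable_killedIter [SFinite μ] (hD : MeasurableSet D) (hH : Measurable H) :
    ∀ n, Measurable (killedIter μ D H n)
  | 0 => hH.indicator hD
  | n + 1 => measurable_killedStep hD (measurable_killedIter hD hH n)

theorem killedStep_mono (hgh : g ≤ h) : killedStep μ D g ≤ killedStep μ D h :=
  fun _ => Set.indicator_le_indicator' fun _ =>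
    Finset.sum_le_sum fun _ _ => lintegral_mono fun _ => hgh _

theorem killedStep_add (hg : Measurable g) :
    killedStep μ D (g + h) = killedStep μ D g + killedStep μ D h := by
  rw [killedStep, killedStep, killedStep, ← Set.indicator_add']
  congr 1
  ext x
  rw [Pi.add_apply, ← Finset.sum_add_distrib]
  refine Finset.sum_congr rfl fun j _ => ?_
  exact lintegral_add_left (hg.comp (measurable_bump x j)) _

theorem killedStep_const_mul (c : ℝ≥0∞) (hg : Measurable g) :
    killedStep μ D (fun x => c * g x) = fun x => c * killedStep μ D g x := by
  ext x
  by_cases hx : x ∈ D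
  · rw [killedStep_of_mem hx, killedStep_of_mem hx]
    rw [Finset.mul_sum]
    refine Finset.sum_congr rfl fun j _ => ?_
    exact lintegral_const_mul _ (hg.comp (measurable_bump x j))
  · simp [killedStep_of_notMem hx]

/-- A linear inequality between the two first iterates propagates to all later ones. -/
theorem killedIter_propagate [SFinite μ] (hD : MeasurableSet D) {H₁ H₂ : (Fin d → ℝ) → ℝ≥0∞}
    (h₁ : Measurable H₁) (h₂ : Measurable H₂) {a b c e a' b' c' e' : ℝ≥0∞}
    (h0 : ∀ x, a * killedIter μ D H₁ 0 x + b * killedIter μ D H₁ 1 x +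
        (c * killedIter μ D H₂ 0 x + e * killedIter μ D H₂ 1 x) ≤
      a' * killedIter μ D H₁ 0 x + b' * killedIter μ D H₁ 1 x +
        (c' * killedIter μ D H₂ 0 x + e' * killedIter μ D H₂ 1 x)) (n : ℕ) :
    ∀ x, a * killedIter μ D H₁ n x + b * killedIter μ D H₁ (n + 1) x +
        (c * killedIter μ D H₂ n x + e * killedIter μ D H₂ (n + 1) x) ≤
      a' * killedIter μ D H₁ n x + b' * killedIter μ D H₁ (n + 1) x +
        (c' * killedIter μ D H₂ n x + e' * killedIter μ D H₂ (n + 1) x) := by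
  induction n with
  | zero => exact h0
  | succ n ih =>
    have m₁ := measurable_killedIter (μ := μ) hD h₁
    have m₂ := measurable_killedIter (μ := μ) hD h₂
    have hlin : ∀ a b c e : ℝ≥0∞,
        killedStep μ D (((fun x => a * killedIter μ D H₁ n x) +
          fun x => b * killedIter μ D H₁ (n + 1) x) +
          ((fun x => c * killedIter μ D H₂ n x) + fun x => e * killedIter μ D H₂ (n + 1) x)) =
        ((fun x => a * killedIter μ D H₁ (n + 1) x) +
          fun x => b * killedIter μ D H₁ (n + 1 + 1) x) +
          ((fun x => c * killedIter μ D H₂ (n + 1) x) +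
            fun x => e * killedIter μ D H₂ (n + 1 + 1) x) := by
      intro a b c e
      rw [killedStep_add (((m₁ n).const_mul a).add ((m₁ (n + 1)).const_mul b)),
        killedStep_add ((m₁ n).const_mul a), killedStep_add ((m₂ n).const_mul c),
        killedStep_const_mul _ (m₁ n), killedStep_const_mul _ (m₁ (n + 1)),
        killedStep_const_mul _ (m₂ n), killedStep_const_mul _ (m₂ (n + 1))]
      rfl
    have h := killedStep_mono (μ := μ) (D := D) (Pi.le_def.2 ih)
    have h' := (hlin a b c e).symm.trans_le (h.trans (hlin a' b' c' e').le)
    exact fun x => h' x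

theorem lintegral_indicator_bump (hD : MeasurableSet D) {F : (Fin d → ℝ) → ℝ}
    (hF : ∀ x ∈ D, 0 ≤ F x) (x : Fin d → ℝ) (j : Fin d)
    (hint : Integrable (fun y => F (bump x j y)) μ) :
    ∫⁻ y, D.indicator (fun z => ENNReal.ofReal (F z)) (bump x j y) ∂μ =
      ENNReal.ofReal (∫ y in {y | bump x j y ∈ D}, F (bump x j y) ∂μ) := by
  have hm : MeasurableSet {y | bump x j y ∈ D} := measurable_bump x j hD
  rw [ofReal_integral_eq_lintegral_ofReal hint.integrableOn
    ((ae_restrict_iff' hm).2 (ae_of_all _ fun y hy => hF _ hy)), ← lintegral_indicator hm]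
  rfl

end KilledStep

/-- A sequence whose increments are controlled by those of a nonnegative nonincreasing sequence. -/
theorem exists_tendsto_of_abs_sub_le {q r : ℕ → ℝ} (hq : ∀ n, 0 ≤ q n) (hr : ∀ n, 0 ≤ r n)
    (h : ∀ n, |q (n + 1) - q n| ≤ r n - r (n + 1)) :
    ∃ L, Tendsto q atTop (𝓝 L) ∧ |L - q 0| ≤ r 0 := by
  have hra : Antitone r := antitone_nat_of_succ_le fun n => by
    linarith [abs_nonneg (q (n + 1) - q n), h n]
  have hca : Antitone fun n => q n + r n := antitone_nat_of_succ_le fun n => by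
    have := (abs_le.1 (h n)).2
    linarith
  have hr' := tendsto_atTop_ciInf hra ⟨0, by rintro _ ⟨n, rfl⟩; exact hr n⟩
  have hc' := tendsto_atTop_ciInf hca
    ⟨0, by rintro _ ⟨n, rfl⟩; exact add_nonneg (hq n) (hr n)⟩
  have hlim := hc'.sub hr'
  simp only [add_sub_cancel_right] at hlim
  refine ⟨_, hlim, ?_⟩
  have hb : ∀ n, |q n - q 0| ≤ r 0 - r n := by
    intro n
    induction n with
    | zero => simp
    | succ n ih =>
      have := abs_sub_le (q (n + 1)) (q n) (q 0)
      linarith [h n]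
  exact le_of_tendsto ((hlim.sub_const _).abs) (Eventually.of_forall fun n =>
    (hb n).trans (by linarith [hr n]))

/-- The weights `e^{-s} s^n / n!` of the Poisson law of mean `s`. -/
noncomputable def poissonWeight (s : ℝ) (n : ℕ) : ℝ := Real.exp (-s) * (s ^ n / n.factorial)

theorem hasSum_poissonWeight (s : ℝ) : HasSum (poissonWeight s) 1 := by
  have h : HasSum (fun n : ℕ => s ^ n / n.factorial) (Real.exp s) := by
    rw [Real.exp_eq_exp_ℝ]
    exact NormedSpace.expSeries_div_hasSum_exp s
  have := h.mul_left (Real.exp (-s))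
  rwa [← Real.exp_add, neg_add_cancel, Real.exp_zero] at this

theorem poissonWeight_nonneg {s : ℝ} (hs : 0 ≤ s) (n : ℕ) : 0 ≤ poissonWeight s n := by
  unfold poissonWeight; positivity

/-- Poisson averages of a convergent sequence converge to its limit as the mean goes to
infinity. -/
theorem tendsto_tsum_poissonWeight {q : ℕ → ℝ} {L : ℝ} (hq : Tendsto q atTop (𝓝 L)) :
    Tendsto (fun s => ∑' n, poissonWeight s n * q n) atTop (𝓝 L) := by
  obtain ⟨B, hB⟩ : ∃ B, ∀ n, |q n - L| ≤ B := by
    obtain ⟨B, hB⟩ := ((hq.sub_const L).abs).bddAbove_range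
    exact ⟨B, fun n => hB ⟨n, rfl⟩⟩
  have hB0 : 0 ≤ B := (abs_nonneg _).trans (hB 0)
  rw [Metric.tendsto_nhds]
  intro ε hε
  obtain ⟨N, hN⟩ := Metric.tendsto_atTop.1 hq (ε / 2) (by positivity)
  have hsmall : Tendsto (fun s => ∑ n ∈ Finset.range N, poissonWeight s n * B) atTop (𝓝 0) := by
    rw [← Finset.sum_const_zero (s := Finset.range N)]
    refine tendsto_finsetSum _ fun n _ => ?_
    have := (Real.tendsto_pow_mul_exp_neg_atTop_nhds_zero n).const_mul (B / n.factorial)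
    rw [mul_zero] at this
    refine this.congr fun s => ?_
    rw [poissonWeight]; ring
  filter_upwards [hsmall.eventually (gt_mem_nhds (half_pos hε)), eventually_ge_atTop 0]
    with s hs hs0
  have hw := hasSum_poissonWeight s
  have hdom : ∀ n, |q n - L| ≤ ε / 2 + if n ∈ Finset.range N then B else 0 := by
    intro n
    split_ifs with hn
    · linarith [hB n]
    · have := hN n (by simpa using hn)
      rw [Real.dist_eq] at this
      linarith
  have hfin : HasSum (fun n => if n ∈ Finset.range N then poissonWeight s n * B else 0)
      (∑ n ∈ Finset.range N, poissonWeight s n * B) := by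
    have := hasSum_sum_of_ne_finset_zero (L := SummationFilter.unconditional ℕ)
      (f := fun n => if n ∈ Finset.range N then poissonWeight s n * B else 0)
      (s := Finset.range N) fun n hn => if_neg hn
    rwa [Finset.sum_congr rfl fun n hn => if_pos hn] at this
  have hmaj := (hw.mul_right (ε / 2)).add hfin
  have hle : ∀ n, ‖poissonWeight s n * (q n - L)‖ ≤ poissonWeight s n * (ε / 2) +
      if n ∈ Finset.range N then poissonWeight s n * B else 0 := by
    intro n
    rw [Real.norm_eq_abs, abs_mul, abs_of_nonneg (poissonWeight_nonneg hs0 n)]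
    refine (mul_le_mul_of_nonneg_left (hdom n) (poissonWeight_nonneg hs0 n)).trans (le_of_eq ?_)
    split_ifs <;> ring
  have hsum : Summable fun n => poissonWeight s n * (q n - L) :=
    Summable.of_norm_bounded hmaj.summable hle
  have heq : ∑' n, poissonWeight s n * q n = ∑' n, poissonWeight s n * (q n - L) + L := by
    have := hsum.hasSum.add (hw.mul_right L)
    rw [one_mul] at this
    rw [← this.tsum_eq]
    exact tsum_congr fun n => by ring
  rw [Real.dist_eq, heq, add_sub_cancel_right, ← Real.norm_eq_abs]
  refine (tsum_of_norm_bounded hmaj hle).trans_lt ?_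
  linarith

/-- The Vandermonde determinant as an extended nonnegative function. -/
noncomputable def vandermondeE {d : ℕ} (x : Fin d → ℝ) : ℝ≥0∞ := ENNReal.ofReal (vandermonde x)

theorem measurable_vandermondeE {d : ℕ} :
    Measurable (vandermondeE : (Fin d → ℝ) → ℝ≥0∞) :=
  measurable_vandermonde.ennreal_ofReal

/-- The normalized killed iterates of the Vandermonde determinant converge, and the limit differs
from the determinant by at most a fraction of order `1 / R` of the spread determinant. -/
theorem exists_tendsto_killedIter {μ : Measure ℝ} [IsProbabilityMeasure μ] {r M : ℝ}
    (hexc : ExcessBound μ r M) (hmom : ∀ n : ℕ, Integrable (fun y : ℝ => y ^ n) μ)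
    {d : ℕ} (hd : 1 ≤ d) {R : ℝ} (hR : 0 < R) (hθ : changeRate d R ≤ r / 2)
    (hθM : changeRate d R * M ≤ r / 4) {x : Fin d → ℝ} (hx : x ∈ weylChamber d) :
    (∀ n, killedIter μ (weylChamber d) vandermondeE n x ≤
      ENNReal.ofReal (d ^ n * vandermonde (spread R x))) ∧
    ∃ L, Tendsto (fun n => (killedIter μ (weylChamber d) vandermondeE n x).toReal / d ^ n)
        atTop (𝓝 L) ∧
      |L - vandermonde x| ≤ 4 * M / (r * R) * vandermonde (spread R x) := by
  set κ := 4 * M / (r * R) with hκ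
  have hr := hexc.rate_pos
  have hM := hexc.const_pos
  have hκ0 : 0 < κ := by positivity
  have hd0 : (0 : ℝ) < d := by exact_mod_cast hd
  let W := weylChamber d
  have hW : MeasurableSet W := measurableSet_weylChamber d
  let H₂ : (Fin d → ℝ) → ℝ≥0∞ := fun x => vandermondeE (spread R x)
  have h₁ : Measurable (vandermondeE : (Fin d → ℝ) → ℝ≥0∞) := measurable_vandermondeE
  have h₂ : Measurable H₂ := h₁.comp (measurable_spread R)
  let u := killedIter μ W vandermondeE
  let v := killedIter μ W H₂
  -- the first iterates, at a point of the chamber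
  have hbase : ∀ z ∈ W, ∃ a b : ℝ, 0 ≤ a ∧ 0 ≤ b ∧
      u 0 z = ENNReal.ofReal (vandermonde z) ∧ u 1 z = ENNReal.ofReal a ∧
      v 0 z = ENNReal.ofReal (vandermonde (spread R z)) ∧ v 1 z = ENNReal.ofReal b ∧
      |a - d * vandermonde z| ≤ κ * (d * vandermonde (spread R z) - b) := by
    intro z hz
    have p1 : ∀ w ∈ W, 0 ≤ vandermonde w := fun w hw => (vandermonde_pos hw).le
    have p2 : ∀ w ∈ W, 0 ≤ vandermonde (spread R w) :=
      fun w hw => (vandermonde_pos (strictMono_spread hR hw.monotone)).le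
    have n1 : ∀ j, 0 ≤ ∫ y in {y | bump z j y ∈ W}, vandermonde (bump z j y) ∂μ := fun j =>
      setIntegral_nonneg (measurable_bump z j hW) fun y hy => p1 _ hy
    have n2 : ∀ j, 0 ≤ ∫ y in {y | bump z j y ∈ W}, vandermonde (spread R (bump z j y)) ∂μ :=
      fun j => setIntegral_nonneg (measurable_bump z j hW) fun y hy => p2 _ hy
    refine ⟨∑ j, ∫ y in {y | bump z j y ∈ W}, vandermonde (bump z j y) ∂μ,
      ∑ j, ∫ y in {y | bump z j y ∈ W}, vandermonde (spread R (bump z j y)) ∂μ,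
      Finset.sum_nonneg fun j _ => n1 j, Finset.sum_nonneg fun j _ => n2 j,
      Set.indicator_of_mem hz _, ?_, Set.indicator_of_mem hz _, ?_, ?_⟩
    · rw [ENNReal.ofReal_sum_of_nonneg fun j _ => n1 j]
      refine (killedStep_of_mem hz).trans (Finset.sum_congr rfl fun j _ => ?_)
      exact lintegral_indicator_bump hW p1 z j (integrable_vandermonde_bump hmom z j)
    · rw [ENNReal.ofReal_sum_of_nonneg fun j _ => n2 j]
      refine (killedStep_of_mem hz).trans (Finset.sum_congr rfl fun j _ => ?_)
      refine lintegral_indicator_bump hW p2 z j ?_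
      simpa only [spread_bump] using integrable_vandermonde_bump hmom (spread R z) j
    · simpa only [spread_bump] using abs_sum_setIntegral_sub_le hexc hmom hR hθ hθM hz
  have hout : ∀ z ∉ W, ∀ n, u n z = 0 ∧ v n z = 0 := by
    intro z hz n
    cases n with
    | zero => exact ⟨Set.indicator_of_notMem hz _, Set.indicator_of_notMem hz _⟩
    | succ n => exact ⟨killedStep_of_notMem hz, killedStep_of_notMem hz⟩
  have hvstep : ∀ n z, v (n + 1) z ≤ d * v n z := by
    intro n z
    have := killedIter_propagate (μ := μ) (a := 0) (b := 0) (c := 0) (e := 1) (a' := 0) (b' := 0)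
      (c' := (d : ℝ≥0∞)) (e' := 0) hW h₁ h₂ (fun z => ?_) n z
    · simpa using this
    · by_cases hz : z ∈ W
      · obtain ⟨a, b, ha, hb, e1, e2, e3, e4, hab⟩ := hbase z hz
        have hle : b ≤ d * vandermonde (spread R z) := by
          have := (abs_nonneg _).trans hab
          linarith [(mul_nonneg_iff_of_pos_left hκ0).1 this]
        change 0 * u 0 z + 0 * u 1 z + (0 * v 0 z + 1 * v 1 z) ≤
          0 * u 0 z + 0 * u 1 z + (d * v 0 z + 0 * v 1 z)
        rw [e3, e4, ← ENNReal.ofReal_natCast d]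
        simp only [zero_mul, zero_add, one_mul, add_zero]
        rw [← ENNReal.ofReal_mul hd0.le]
        exact ENNReal.ofReal_le_ofReal hle
      · have h0 := hout z hz 0
        have h1 := hout z hz 1
        change 0 * u 0 z + 0 * u 1 z + (0 * v 0 z + 1 * v 1 z) ≤ _
        simp [h0, h1]
  have huv : ∀ n, u n ≤ v n := by
    intro n
    induction n with
    | zero =>
      exact fun z => Set.indicator_le_indicator' fun hz =>
        ENNReal.ofReal_le_ofReal (vandermonde_le_spread hR.le hz)
    | succ n ih => exact killedStep_mono ih
  have hvbound : ∀ n, v n x ≤ ENNReal.ofReal (d ^ n * vandermonde (spread R x)) := by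
    intro n
    induction n with
    | zero =>
      rw [pow_zero, one_mul]
      exact (Set.indicator_of_mem hx _).le
    | succ n ih =>
      refine (hvstep n x).trans ?_
      rw [pow_succ', mul_assoc, ENNReal.ofReal_mul hd0.le, ENNReal.ofReal_natCast]
      gcongr
  have hvfin : ∀ n, v n x ≠ ⊤ := fun n => ((hvbound n).trans_lt ENNReal.ofReal_lt_top).ne
  have hufin : ∀ n, u n x ≠ ⊤ := fun n => ((huv n x).trans_lt (hvfin n).lt_top).ne
  set K := ENNReal.ofReal κ with hK
  have hup : ∀ n, u (n + 1) x + K * v (n + 1) x ≤ d * u n x + d * K * v n x := by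
    intro n
    have := killedIter_propagate (μ := μ) (a := 0) (b := 1) (c := 0) (e := K) (a' := (d : ℝ≥0∞))
      (b' := 0) (c' := d * K) (e' := 0) hW h₁ h₂ (fun z => ?_) n x
    · simpa using this
    · change 0 * u 0 z + 1 * u 1 z + (0 * v 0 z + K * v 1 z) ≤
          d * u 0 z + 0 * u 1 z + (d * K * v 0 z + 0 * v 1 z)
      by_cases hz : z ∈ W
      · obtain ⟨a, b, ha, hb, e1, e2, e3, e4, hab⟩ := hbase z hz
        have p1 := (vandermonde_pos hz).le
        have p2 := (vandermonde_pos (strictMono_spread hR hz.monotone)).le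
        rw [e1, e2, e3, e4, ← ENNReal.ofReal_natCast d, hK]
        simp only [zero_mul, zero_add, one_mul, add_zero]
        rw [← ENNReal.ofReal_mul hd0.le, ← ENNReal.ofReal_mul hd0.le, ← ENNReal.ofReal_mul hκ0.le,
          ← ENNReal.ofReal_mul (by positivity), ← ENNReal.ofReal_add ha (by positivity),
          ← ENNReal.ofReal_add (by positivity) (by positivity)]
        refine ENNReal.ofReal_le_ofReal ?_
        have := (abs_le.1 hab).2
        linarith
      · simp [hout z hz 1]
  have hlow : ∀ n, d * u n x + K * v (n + 1) x ≤ u (n + 1) x + d * K * v n x := by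
    intro n
    have := killedIter_propagate (μ := μ) (a := (d : ℝ≥0∞)) (b := 0) (c := 0) (e := K) (a' := 0)
      (b' := 1) (c' := d * K) (e' := 0) hW h₁ h₂ (fun z => ?_) n x
    · simpa using this
    · change d * u 0 z + 0 * u 1 z + (0 * v 0 z + K * v 1 z) ≤
          0 * u 0 z + 1 * u 1 z + (d * K * v 0 z + 0 * v 1 z)
      by_cases hz : z ∈ W
      · obtain ⟨a, b, ha, hb, e1, e2, e3, e4, hab⟩ := hbase z hz
        have p1 := (vandermonde_pos hz).le
        have p2 := (vandermonde_pos (strictMono_spread hR hz.monotone)).le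
        rw [e1, e2, e3, e4, ← ENNReal.ofReal_natCast d, hK]
        simp only [zero_mul, zero_add, one_mul, add_zero]
        rw [← ENNReal.ofReal_mul hd0.le, ← ENNReal.ofReal_mul hd0.le, ← ENNReal.ofReal_mul hκ0.le,
          ← ENNReal.ofReal_mul (by positivity),
          ← ENNReal.ofReal_add (by positivity) (by positivity),
          ← ENNReal.ofReal_add ha (by positivity)]
        refine ENNReal.ofReal_le_ofReal ?_
        have := (abs_le.1 hab).1
        linarith
      · simp [hout z hz 1, hout z hz 0]
  refine ⟨fun n => (huv n x).trans (hvbound n), ?_⟩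
  have hstep : ∀ n, |(u (n + 1) x).toReal / d ^ (n + 1) - (u n x).toReal / d ^ n| ≤
      κ * ((v n x).toReal / d ^ n) - κ * ((v (n + 1) x).toReal / d ^ (n + 1)) := by
    intro n
    have hKv : ∀ m, K * v m x ≠ ⊤ := fun m => ENNReal.mul_ne_top ENNReal.ofReal_ne_top (hvfin m)
    have hdu : ∀ m, d * u m x ≠ ⊤ := fun m =>
      ENNReal.mul_ne_top (ENNReal.natCast_ne_top d) (hufin m)
    have hdKv : ∀ m, d * K * v m x ≠ ⊤ := fun m => by
      rw [mul_assoc]; exact ENNReal.mul_ne_top (ENNReal.natCast_ne_top d) (hKv m)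
    have h1 := ENNReal.toReal_mono (ENNReal.add_ne_top.2 ⟨hdu n, hdKv n⟩) (hup n)
    have h2 := ENNReal.toReal_mono (ENNReal.add_ne_top.2 ⟨hufin (n + 1), hdKv n⟩) (hlow n)
    rw [ENNReal.toReal_add (hufin _) (hKv _), ENNReal.toReal_add (hdu n) (hdKv n)] at h1
    rw [ENNReal.toReal_add (hdu n) (hKv _), ENNReal.toReal_add (hufin _) (hdKv n)] at h2
    simp only [ENNReal.toReal_mul, ENNReal.toReal_natCast, hK, ENNReal.toReal_ofReal hκ0.le]
      at h1 h2
    have hpow : (0 : ℝ) < d ^ (n + 1) := by positivity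
    have e : ∀ s : ℝ, s / d ^ n = d * s / d ^ (n + 1) := fun s => by
      rw [pow_succ']; field_simp
    rw [e, e, ← sub_div, abs_div, abs_of_pos hpow, mul_div_assoc', mul_div_assoc', ← sub_div]
    refine div_le_div_of_nonneg_right ?_ hpow.le
    rw [abs_le]
    constructor <;> linarith
  obtain ⟨L, hL, hL0⟩ := exists_tendsto_of_abs_sub_le
    (q := fun n => (u n x).toReal / d ^ n) (r := fun n => κ * ((v n x).toReal / d ^ n))
    (fun n => by positivity) (fun n => by positivity) hstep
  refine ⟨L, hL, ?_⟩
  have e1 : u 0 x = ENNReal.ofReal (vandermonde x) := Set.indicator_of_mem hx _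
  have e2 : v 0 x = ENNReal.ofReal (vandermonde (spread R x)) := Set.indicator_of_mem hx _
  simpa [e1, e2, (vandermonde_pos hx).le,
    (vandermonde_pos (strictMono_spread hR hx.monotone)).le] using hL0

/-! ### The strong Markov property at the first jump -/

/-- Restricting some coordinates of a product of copies of `ν` to `A` and transforming them by `T`
reproduces the product law, if `T` maps `ν` restricted to `A` to a multiple of `ν`. -/
theorem map_restrict_infinitePi {ι X : Type*} [DecidableEq ι] [MeasurableSpace X] {ν : Measure X}
    [IsProbabilityMeasure ν] {A : Set X} (hA : MeasurableSet A) {T : X → X} (hT : Measurable T)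
    {c : ℝ≥0∞} (hc0 : c ≠ 0) (hc : c ≠ ⊤) (h : (ν.restrict A).map T = c • ν) (F : Finset ι) :
    ((Measure.infinitePi fun _ : ι => ν).restrict {ω | ∀ i ∈ F, ω i ∈ A}).map
      (fun ω i => if i ∈ F then T (ω i) else ω i) =
      c ^ F.card • Measure.infinitePi fun _ : ι => ν := by
  set P := Measure.infinitePi fun _ : ι => ν with hP
  have hval : ∀ t : Set X, MeasurableSet t → ν (A ∩ T ⁻¹' t) = c * ν t := by
    intro t ht
    have := congrArg (fun m : Measure X => m t) h
    simp only [Measure.map_apply hT ht, Measure.restrict_apply (hT ht), Measure.smul_apply,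
      smul_eq_mul] at this
    rw [Set.inter_comm, this]
  have hmap : Measurable fun (ω : ι → X) i => if i ∈ F then T (ω i) else ω i := by
    refine measurable_pi_iff.2 fun i => ?_
    by_cases hi : i ∈ F
    · simp only [hi, if_true]
      exact hT.comp (measurable_pi_apply i)
    · simp only [hi, if_false]
      exact measurable_pi_apply i
  have hinv : (c⁻¹) ^ F.card • ((P.restrict {ω | ∀ i ∈ F, ω i ∈ A}).map
      (fun ω i => if i ∈ F then T (ω i) else ω i)) = P := by
    refine Measure.eq_infinitePi _ fun s t ht => ?_
    have hpi : MeasurableSet ((s : Set ι).pi t) :=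
      MeasurableSet.pi s.countable_toSet fun i _ => ht i
    let t' : ι → Set X := fun i =>
      if i ∈ F then (if i ∈ s then A ∩ T ⁻¹' t i else A) else (if i ∈ s then t i else Set.univ)
    have hset : (fun (ω : ι → X) i => if i ∈ F then T (ω i) else ω i) ⁻¹' (s : Set ι).pi t ∩
        {ω | ∀ i ∈ F, ω i ∈ A} = Set.pi ((F ∪ s : Finset ι) : Set ι) t' := by
      ext ω
      simp only [Set.mem_inter_iff, Set.mem_preimage, Set.mem_pi, Set.mem_ofPred_eq,
        Finset.mem_coe, Finset.mem_union, t']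
      constructor
      · rintro ⟨h1, h2⟩ i -
        by_cases hF : i ∈ F <;> by_cases hs : i ∈ s
        · simpa [hF, hs] using ⟨h2 i hF, by simpa [hF] using h1 i hs⟩
        · simpa [hF, hs] using h2 i hF
        · simpa [hF, hs] using h1 i hs
        · simp [hF, hs]
      · intro h1
        constructor
        · intro i hs
          have := h1 i (Or.inr hs)
          by_cases hF : i ∈ F
          · simp only [hF, hs, if_true] at this ⊢
            exact this.2
          · simpa [hF, hs] using this
        · intro i hF
          have := h1 i (Or.inl hF)
          by_cases hs : i ∈ s
          · simp only [hF, hs, if_true] at this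
            exact this.1
          · simpa [hF, hs] using this
    have ht' : ∀ i, MeasurableSet (t' i) := by
      intro i
      simp only [t']
      split_ifs
      · exact hA.inter (hT (ht i))
      · exact hA
      · exact ht i
      · exact MeasurableSet.univ
    have hfac : ∀ i ∈ F ∪ s, ν (t' i) =
        (if i ∈ F then c else 1) * (if i ∈ s then ν (t i) else 1) := by
      intro i _
      simp only [t']
      split_ifs
      · exact hval _ (ht i)
      · simpa using hval Set.univ MeasurableSet.univ
      · simp
      · simp
    rw [Measure.smul_apply, Measure.map_apply hmap hpi, Measure.restrict_apply (hmap hpi), hset,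
      hP, Measure.infinitePi_pi _ fun i _ => ht' i, Finset.prod_congr rfl hfac,
      Finset.prod_mul_distrib, Finset.prod_ite_mem, Finset.prod_ite_mem,
      Finset.inter_eq_right.2 Finset.subset_union_left,
      Finset.inter_eq_right.2 Finset.subset_union_right, Finset.prod_const, smul_eq_mul,
      ← mul_assoc, ← mul_pow, ENNReal.inv_mul_cancel hc0 hc, one_pow, one_mul]
  rw [← hinv, smul_smul, ← mul_pow, ENNReal.mul_inv_cancel hc0 hc, one_pow, one_smul, hinv]

/-- The law of the pair of a waiting time and a jump. -/
noncomputable def stepLaw (μ : Measure ℝ) : Measure (ℝ × ℝ) := (expMeasure 1).prod μ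

instance : IsProbabilityMeasure (expMeasure 1) := isProbabilityMeasure_expMeasure one_pos

instance (μ : Measure ℝ) [IsProbabilityMeasure μ] : IsProbabilityMeasure (stepLaw μ) := by
  unfold stepLaw; infer_instance

theorem walkMeasure_eq (μ : Measure ℝ) [IsProbabilityMeasure μ] (d : ℕ) :
    walkMeasure μ d = Measure.infinitePi fun _ : ℕ × Fin d => stepLaw μ := rfl

instance (μ : Measure ℝ) [IsProbabilityMeasure μ] (d : ℕ) :
    IsProbabilityMeasure (walkMeasure μ d) := by
  rw [walkMeasure_eq]; infer_instance

theorem lintegral_expMeasure {g : ℝ → ℝ≥0∞} (hg : Measurable g) :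
    ∫⁻ s, g s ∂(expMeasure 1) = ∫⁻ s in Set.Ioi 0, ENNReal.ofReal (Real.exp (-s)) * g s := by
  have h1 : expMeasure 1 = volume.withDensity (exponentialPDF 1) := rfl
  have h2 : Measurable (exponentialPDF 1) := (measurable_exponentialPDFReal 1).ennreal_ofReal
  rw [h1, lintegral_withDensity_eq_lintegral_mul _ h2 hg,
    setLIntegral_congr (Ioi_ae_eq_Ici (a := (0 : ℝ))), ← lintegral_indicator measurableSet_Ici]
  refine lintegral_congr fun s => ?_
  by_cases hs : 0 ≤ s
  · rw [Set.indicator_of_mem (Set.mem_Ici.2 hs), Pi.mul_apply, exponentialPDF_of_nonneg hs]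
    simp
  · rw [Set.indicator_of_notMem (by simpa using hs), Pi.mul_apply,
      exponentialPDF_of_neg (not_le.1 hs), zero_mul]

/-- The exponential law has no memory. -/
theorem map_sub_expMeasure {s : ℝ} (hs : 0 ≤ s) :
    ((expMeasure 1).restrict (Set.Ioi s)).map (fun u => u - s) =
      ENNReal.ofReal (Real.exp (-s)) • expMeasure 1 := by
  ext A hA
  have hm : Measurable fun u : ℝ => u - s := measurable_sub_const s
  have hval : ∀ B : Set ℝ, MeasurableSet B → expMeasure 1 B =
      ∫⁻ u, (Set.Ioi 0 ∩ B).indicator (fun u => ENNReal.ofReal (Real.exp (-u))) u := by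
    intro B hB
    rw [← lintegral_indicator_one hB, lintegral_expMeasure (measurable_one.indicator hB),
      ← lintegral_indicator measurableSet_Ioi]
    refine lintegral_congr fun u => ?_
    by_cases h1 : u ∈ Set.Ioi (0 : ℝ) <;> by_cases h2 : u ∈ B <;> simp [h1, h2]
  rw [Measure.map_apply hm hA, Measure.restrict_apply (hm hA), Measure.smul_apply, smul_eq_mul,
    hval A hA, hval _ ((hm hA).inter measurableSet_Ioi), ← lintegral_const_mul',
    ← lintegral_sub_right_eq_self (fun u => ENNReal.ofReal (Real.exp (-s)) *
      (Set.Ioi 0 ∩ A).indicator (fun u => ENNReal.ofReal (Real.exp (-u))) u) s]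
  · refine lintegral_congr fun u => ?_
    by_cases h1 : u - s ∈ Set.Ioi 0 ∩ A
    · have h0 : 0 < u - s := h1.1
      rw [Set.indicator_of_mem h1, Set.indicator_of_mem, ← ENNReal.ofReal_mul (Real.exp_pos _).le,
        ← Real.exp_add]
      · ring_nf
      · exact ⟨by simp only [Set.mem_Ioi]; linarith, h1.2, by simp only [Set.mem_Ioi]; linarith⟩
    · rw [Set.indicator_of_notMem h1, Set.indicator_of_notMem, mul_zero]
      rintro ⟨-, h2, h3⟩
      exact h1 ⟨Set.mem_Ioi.2 (sub_pos.2 h3), h2⟩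
  · exact ENNReal.ofReal_ne_top

theorem map_sub_stepLaw (μ : Measure ℝ) [IsProbabilityMeasure μ] {s : ℝ} (hs : 0 ≤ s) :
    ((stepLaw μ).restrict {q | s < q.1}).map (fun q => (q.1 - s, q.2)) =
      ENNReal.ofReal (Real.exp (-s)) • stepLaw μ := by
  have h1 : {q : ℝ × ℝ | s < q.1} = Set.Ioi s ×ˢ Set.univ := by
    ext q; simp
  have h2 : (fun q : ℝ × ℝ => (q.1 - s, q.2)) = Prod.map (fun u => u - s) id := rfl
  rw [h1, h2, stepLaw, ← Measure.prod_restrict, ← Measure.map_prod_map _ _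
    (measurable_sub_const s) measurable_id, map_sub_expMeasure hs, Measure.restrict_univ,
    Measure.map_id, Measure.prod_smul_left]

variable {d : ℕ}

/-- The event that walker `j` is the only one to make the first jump, after a positive time. -/
def firstJump (j : Fin d) : Set (Sample d) :=
  {ω | 0 < (ω (0, j)).1 ∧ ∀ k, k ≠ j → (ω (0, j)).1 < (ω (0, k)).1}

/-- The sample seen from the first jump, made by walker `j`: this walker forgets its first step, the
others have waited for the time that has passed. -/
def restart (j : Fin d) (ω : Sample d) : Sample d := fun p =>
  if p.2 = j then ω (p.1 + 1, j)
  else if p.1 = 0 then ((ω p).1 - (ω (0, j)).1, (ω p).2) else ω p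

/-- The sample in which walker `j` makes the step `q` before its steps in `ω`. -/
def prependStep (j : Fin d) (q : ℝ × ℝ) (ω : Sample d) : Sample d := fun p =>
  if p.2 = j then (if p.1 = 0 then q else ω (p.1 - 1, j)) else ω p

theorem measurable_prependStep (j : Fin d) :
    Measurable fun p : (ℝ × ℝ) × Sample d => prependStep j p.1 p.2 := by
  refine measurable_pi_iff.2 fun i => ?_
  simp only [prependStep]
  split_ifs
  · exact measurable_fst
  · exact (measurable_pi_apply _).comp measurable_snd
  · exact (measurable_pi_apply _).comp measurable_snd

theorem measurable_restart (j : Fin d) : Measurable (restart j : Sample d → Sample d) := by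
  refine measurable_pi_iff.2 fun i => ?_
  simp only [restart]
  split_ifs
  · exact measurable_pi_apply _
  · fun_prop
  · exact measurable_pi_apply _

theorem measurableSet_firstJump (j : Fin d) : MeasurableSet (firstJump j) := by
  have : firstJump j = {ω : Sample d | 0 < (ω (0, j)).1} ∩
      ⋂ k, ⋂ (_ : k ≠ j), {ω | (ω (0, j)).1 < (ω (0, k)).1} := by
    ext ω; simp [firstJump]
  rw [this]
  refine (measurableSet_lt measurable_const (by fun_prop)).inter ?_
  exact MeasurableSet.iInter fun k => MeasurableSet.iInter fun _ =>
    measurableSet_lt (by fun_prop) (by fun_prop)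

/-- The steps being independent with the same law, one more independent step in front of those of
walker `j` does not change the law of the sample. -/
theorem map_prependStep (μ : Measure ℝ) [IsProbabilityMeasure μ] (j : Fin d) :
    ((stepLaw μ).prod (walkMeasure μ d)).map (fun p => prependStep j p.1 p.2) =
      walkMeasure μ d := by
  rw [walkMeasure_eq]
  refine Measure.eq_infinitePi _ fun s t ht => ?_
  let next : ℕ × Fin d → ℕ × Fin d := fun p => if p.2 = j then (p.1 + 1, p.2) else p
  have hnext : Function.Injective next := by
    rintro ⟨i, k⟩ ⟨i', k'⟩ h
    simp only [next] at h
    split_ifs at h with h1 h2 h2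
    · simpa using h
    · simp only [Prod.mk.injEq] at h; exact absurd (h.2 ▸ h1) h2
    · simp only [Prod.mk.injEq] at h; exact absurd (h.2.symm ▸ h2) h1
    · exact h
  have hrange : ∀ p, p ∉ Set.range next ↔ p = (0, j) := by
    rintro ⟨i, k⟩
    constructor
    · intro h
      by_contra hne
      refine h ?_
      by_cases hk : k = j
      · have hi : i ≠ 0 := by rintro rfl; exact hne (by rw [hk])
        exact ⟨(i - 1, k), by simp [next, hk, Nat.sub_add_cancel (Nat.pos_of_ne_zero hi)]⟩
      · exact ⟨(i, k), by simp [next, hk]⟩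
    · rintro h ⟨⟨i', k'⟩, h'⟩
      rw [h] at h'
      simp only [next] at h'
      split_ifs at h' with h1
      · simp at h'
      · simp only [Prod.mk.injEq] at h'
        exact h1 h'.2
  have hat : ∀ (q : ℝ × ℝ) (ω : Sample d) p, prependStep j q ω (next p) = ω p := by
    rintro q ω ⟨i, k⟩
    by_cases hk : k = j <;> simp [prependStep, next, hk]
  have hset : (fun p : (ℝ × ℝ) × Sample d => prependStep j p.1 p.2) ⁻¹' (s : Set _).pi t =
      (if (0, j) ∈ s then t (0, j) else Set.univ) ×ˢ
        ((s.preimage next hnext.injOn : Finset _) : Set (ℕ × Fin d)).pi fun p => t (next p) := by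
    ext ⟨q, ω⟩
    simp only [Set.mem_preimage, Set.mem_pi, Finset.mem_coe, Set.mem_prod, Finset.mem_preimage]
    constructor
    · intro h
      refine ⟨?_, fun p hp => ?_⟩
      · split_ifs with h0
        · simpa [prependStep] using h _ h0
        · trivial
      · rw [← hat q ω p]; exact h _ hp
    · rintro ⟨h1, h2⟩ p hp
      by_cases hr : p ∈ Set.range next
      · obtain ⟨p', rfl⟩ := hr
        rw [hat]
        exact h2 p' hp
      · rw [(hrange p).1 hr] at hp ⊢
        rw [if_pos hp] at h1
        simpa [prependStep] using h1
  rw [Measure.map_apply (measurable_prependStep j)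
    (MeasurableSet.pi s.countable_toSet fun i _ => ht i), hset, Measure.prod_prod,
    Measure.infinitePi_pi _ fun p _ => ht (next p)]
  have hdec : DecidablePred fun p => p ∈ Set.range next := Classical.decPred _
  rw [Finset.prod_preimage' next s hnext.injOn fun p => stepLaw μ (t p),
    ← Finset.prod_filter_not_mul_prod_filter s (fun p => p ∈ Set.range next)]
  congr 1
  rw [Finset.filter_congr fun p _ => hrange p, Finset.prod_filter, Finset.prod_ite_eq']
  split_ifs <;> simp

/-- The strong Markov property at the first jump: on the event that it is made by walker `j`, its
time has density `e^{-d s}`, the jump has law `μ`, and what follows is an independent copy. -/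
theorem lintegral_firstJump (μ : Measure ℝ) [IsProbabilityMeasure μ] (j : Fin d)
    {F : ℝ → ℝ → Sample d → ℝ≥0∞}
    (hF : Measurable fun p : ℝ × ℝ × Sample d => F p.1 p.2.1 p.2.2) :
    ∫⁻ ω in firstJump j, F (ω (0, j)).1 (ω (0, j)).2 (restart j ω) ∂(walkMeasure μ d) =
      ∫⁻ s in Set.Ioi 0, ENNReal.ofReal (Real.exp (-(d * s))) *
        ∫⁻ y, ∫⁻ ω, F s y ω ∂(walkMeasure μ d) ∂μ := by
  set P := walkMeasure μ d with hP
  have hG : Measurable fun ω : Sample d => F (ω (0, j)).1 (ω (0, j)).2 (restart j ω) :=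
    hF.comp ((measurable_fst.comp (measurable_pi_apply _)).prodMk
      ((measurable_snd.comp (measurable_pi_apply _)).prodMk (measurable_restart j)))
  have hGi := hG.indicator (measurableSet_firstJump j)
  have hGp : Measurable fun p : (ℝ × ℝ) × Sample d => (firstJump j).indicator
      (fun ω => F (ω (0, j)).1 (ω (0, j)).2 (restart j ω)) (prependStep j p.1 p.2) :=
    hGi.comp (measurable_prependStep j)
  rw [← lintegral_indicator (measurableSet_firstJump j)]
  conv_lhs => rw [hP, ← map_prependStep μ j]
  rw [lintegral_map hGi (measurable_prependStep j),
    lintegral_prod _ hGp.aemeasurable]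
  have hinner : ∀ q : ℝ × ℝ, 0 < q.1 →
      ∫⁻ ω, (firstJump j).indicator (fun ω => F (ω (0, j)).1 (ω (0, j)).2 (restart j ω))
        (prependStep j q ω) ∂P =
      ENNReal.ofReal (Real.exp (-q.1)) ^ (d - 1) * ∫⁻ ω, F q.1 q.2 ω ∂P := by
    intro q hq
    let I : Finset (ℕ × Fin d) := (Finset.univ.erase j).map ⟨fun k => (0, k), fun k k' h => by
      simpa using h⟩
    have hI : I.card = d - 1 := by simp [I]
    have hmemI : ∀ p, p ∈ I ↔ p.1 = 0 ∧ p.2 ≠ j := by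
      rintro ⟨i, k⟩
      simp only [I, Finset.mem_map, Finset.mem_erase, Finset.mem_univ, and_true]
      constructor
      · rintro ⟨k', h1, h2⟩; cases h2; exact ⟨rfl, h1⟩
      · rintro ⟨rfl, h2⟩; exact ⟨k, h2, rfl⟩
    have hA : MeasurableSet {r : ℝ × ℝ | q.1 < r.1} :=
      measurableSet_lt measurable_const measurable_fst
    have hT : Measurable fun r : ℝ × ℝ => (r.1 - q.1, r.2) := by fun_prop
    have hmap := map_restrict_infinitePi hA hT (ENNReal.ofReal_pos.2 (Real.exp_pos _)).ne'
      ENNReal.ofReal_ne_top (map_sub_stepLaw μ hq.le) I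
    rw [← walkMeasure_eq, ← hP, hI] at hmap
    have hB : MeasurableSet {ω : Sample d | ∀ i ∈ I, ω i ∈ {r : ℝ × ℝ | q.1 < r.1}} := by
      have : {ω : Sample d | ∀ i ∈ I, ω i ∈ {r : ℝ × ℝ | q.1 < r.1}} =
          (I : Set (ℕ × Fin d)).pi fun _ => {r : ℝ × ℝ | q.1 < r.1} := by
        ext ω; simp
      rw [this]
      exact MeasurableSet.pi I.countable_toSet fun _ _ => hA
    have hlow : Measurable fun (ω : Sample d) i =>
        if i ∈ I then ((ω i).1 - q.1, (ω i).2) else ω i := by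
      refine measurable_pi_iff.2 fun i => ?_
      split_ifs
      · fun_prop
      · exact measurable_pi_apply i
    have hFq : Measurable fun ω => F q.1 q.2 ω :=
      hF.comp (measurable_const.prodMk (measurable_const.prodMk measurable_id))
    have hint := congrArg (fun m : Measure (Sample d) => ∫⁻ ω, F q.1 q.2 ω ∂m) hmap
    simp only [lintegral_smul_measure, smul_eq_mul] at hint
    rw [← hint, lintegral_map hFq hlow, ← lintegral_indicator hB]
    refine lintegral_congr fun ω => ?_
    have h0 : prependStep j q ω (0, j) = q := by simp [prependStep]
    have hk : ∀ k, k ≠ j → prependStep j q ω (0, k) = ω (0, k) := fun k hk => by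
      simp [prependStep, hk]
    have hmem : prependStep j q ω ∈ firstJump j ↔
        ω ∈ {ω : Sample d | ∀ i ∈ I, ω i ∈ {r : ℝ × ℝ | q.1 < r.1}} := by
      simp only [firstJump, Set.mem_ofPred_eq, h0]
      constructor
      · rintro ⟨-, h⟩ ⟨i, k⟩ hi
        obtain ⟨h1, h2⟩ := (hmemI _).1 hi
        simp only at h1 h2
        subst h1
        have := h k h2
        rwa [hk k h2] at this
      · intro h
        refine ⟨hq, fun k hkj => ?_⟩
        rw [hk k hkj]
        exact h (0, k) ((hmemI _).2 ⟨rfl, hkj⟩)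
    by_cases hm : prependStep j q ω ∈ firstJump j
    · rw [Set.indicator_of_mem hm, Set.indicator_of_mem (hmem.1 hm), h0]
      congr 1
      ext1 ⟨i, k⟩
      by_cases hkj : k = j
      · simp [restart, prependStep, hmemI, hkj]
      · by_cases hi : i = 0
        · simp [restart, prependStep, hmemI, hkj, hi]
        · simp [restart, prependStep, hmemI, hkj, hi]
    · rw [Set.indicator_of_notMem hm, Set.indicator_of_notMem (fun h => hm (hmem.2 h))]
  have hmeasL : Measurable fun q : ℝ × ℝ => ∫⁻ ω, (firstJump j).indicator
      (fun ω => F (ω (0, j)).1 (ω (0, j)).2 (restart j ω)) (prependStep j q ω) ∂P :=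
    hGp.lintegral_prod_right'
  rw [stepLaw, lintegral_prod _ hmeasL.aemeasurable,
    lintegral_expMeasure hmeasL.lintegral_prod_right']
  refine setLIntegral_congr_fun measurableSet_Ioi fun s hs => ?_
  have hs' : ∀ y, ∫⁻ ω, (firstJump j).indicator
      (fun ω => F (ω (0, j)).1 (ω (0, j)).2 (restart j ω)) (prependStep j (s, y) ω) ∂P =
      ENNReal.ofReal (Real.exp (-s)) ^ (d - 1) * ∫⁻ ω, F s y ω ∂P := fun y => hinner (s, y) hs
  rw [lintegral_congr hs', lintegral_const_mul' _ _
    (ENNReal.pow_ne_top ENNReal.ofReal_ne_top), ← mul_assoc, ← pow_succ',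
    Nat.sub_add_cancel (Nat.one_le_of_lt j.2), ← ENNReal.ofReal_pow (Real.exp_pos _).le,
    ← Real.exp_nat_mul]
  ring_nf

/-! ### Reduction of the walk to its jump chain -/

open Classical in
/-- The value of `H` at the position reached at time `t` from `x`, on the event that exactly `n`
jumps are made by time `t`, that they are made one at a time, and that the positions up to time `t`
all lie in `D`; the value is `0` off this event. -/
noncomputable def chainValue (D : Set (Fin d → ℝ)) (H : (Fin d → ℝ) → ℝ≥0∞) :
    ℕ → (Fin d → ℝ) → ℝ → Sample d → ℝ≥0∞
  | 0, x, t, ω => if ∀ k, t < (ω (0, k)).1 then D.indicator H x else 0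
  | n + 1, x, t, ω => D.indicator (fun x => ∑ j,
      if ω ∈ firstJump j ∧ (ω (0, j)).1 ≤ t then
        chainValue D H n (bump x j (ω (0, j)).2) (t - (ω (0, j)).1) (restart j ω) else 0) x

/-- The event that exactly `n` jumps are made by time `t` and that they are made one at a time. -/
def JumpCount : ℕ → ℝ → Sample d → Prop
  | 0, t, ω => ∀ k, t < (ω (0, k)).1
  | n + 1, t, ω => ∃ j, ω ∈ firstJump j ∧ (ω (0, j)).1 ≤ t ∧
      JumpCount n (t - (ω (0, j)).1) (restart j ω)

/-- The walk from `x` stays in `D` up to time `t` and a little longer. -/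
def StaysIn (D : Set (Fin d → ℝ)) (x : Fin d → ℝ) (t : ℝ) (ω : Sample d) : Prop :=
  ∃ r, t < r ∧ ∀ s, 0 ≤ s → s < r → walk x s ω ∈ D

theorem mem_survival_iff {x : Fin d → ℝ} {t : ℝ} {ω : Sample d} :
    ω ∈ survival x t ↔ StaysIn (weylChamber d) x t ω := by
  constructor
  · intro h
    obtain ⟨r, hr1, hr2⟩ := EReal.lt_iff_exists_real_btwn.1 h
    refine ⟨r, by exact_mod_cast hr1, fun s hs0 hsr => ?_⟩
    by_contra hs
    have h1 : exitTime x ω ≤ (s : EReal) := sInf_le ⟨s, ⟨hs0, hs⟩, rfl⟩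
    exact absurd (hr2.trans_le h1) (not_lt.2 (by exact_mod_cast hsr.le))
  · rintro ⟨r, hr, h⟩
    have h1 : (r : EReal) ≤ exitTime x ω := by
      refine le_sInf ?_
      rintro _ ⟨s, ⟨hs0, hs⟩, rfl⟩
      by_contra hlt
      exact hs (h s hs0 (EReal.coe_lt_coe_iff.1 (not_le.1 hlt)))
    exact lt_of_lt_of_le (by exact_mod_cast hr) h1

theorem firstJump_unique {j k : Fin d} {ω : Sample d} (hj : ω ∈ firstJump j)
    (hk : ω ∈ firstJump k) : j = k := by
  by_contra h
  exact lt_asymm (hj.2 k (Ne.symm h)) (hk.2 j h)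

theorem jumpCount_of_chainValue_ne_zero {D : Set (Fin d → ℝ)} {H : (Fin d → ℝ) → ℝ≥0∞} :
    ∀ {n : ℕ} {x : Fin d → ℝ} {t : ℝ} {ω : Sample d}, chainValue D H n x t ω ≠ 0 →
      JumpCount n t ω
  | 0, x, t, ω, h => by
    by_contra hc
    exact h (if_neg hc)
  | n + 1, x, t, ω, h => by
    by_contra hc
    refine h ?_
    rw [chainValue]
    by_cases hx : x ∈ D
    · rw [Set.indicator_of_mem hx]
      refine Finset.sum_eq_zero fun j _ => ?_
      split_ifs with hj
      · by_contra h0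
        exact hc ⟨j, hj.1, hj.2, jumpCount_of_chainValue_ne_zero h0⟩
      · rfl
    · exact Set.indicator_of_notMem hx _

theorem JumpCount.unique : ∀ {n m : ℕ} {t : ℝ} {ω : Sample d}, JumpCount n t ω →
    JumpCount m t ω → n = m
  | 0, 0, _, _, _, _ => rfl
  | 0, m + 1, _, _, h, ⟨j, _, h2, _⟩ => absurd (h j) (not_lt.2 h2)
  | n + 1, 0, _, _, ⟨j, _, h2, _⟩, h => absurd (h j) (not_lt.2 h2)
  | n + 1, m + 1, _, _, ⟨j, h1, _, h3⟩, ⟨k, h1', _, h3'⟩ => by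
    obtain rfl := firstJump_unique h1 h1'
    rw [JumpCount.unique h3 h3']

/-- On the event that walker `j` makes the first jump, by time `t`, only this walker contributes to
the recursion. -/
theorem chainValue_succ_of_firstJump {D : Set (Fin d → ℝ)} {H : (Fin d → ℝ) → ℝ≥0∞} {n : ℕ}
    {x : Fin d → ℝ} {t : ℝ} {ω : Sample d} {j : Fin d} (hj : ω ∈ firstJump j)
    (ht : (ω (0, j)).1 ≤ t) (hx : x ∈ D) :
    chainValue D H (n + 1) x t ω =
      chainValue D H n (bump x j (ω (0, j)).2) (t - (ω (0, j)).1) (restart j ω) := by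
  rw [chainValue, Set.indicator_of_mem hx, Finset.sum_eq_single j, if_pos ⟨hj, ht⟩]
  · exact fun k _ hk => if_neg fun h => hk (firstJump_unique h.1 hj)
  · exact fun h => absurd (Finset.mem_univ j) h

theorem chainValue_univ_one : ∀ {n : ℕ} {x : Fin d → ℝ} {t : ℝ} {ω : Sample d},
    JumpCount n t ω → chainValue Set.univ (fun _ => 1) n x t ω = 1
  | 0, x, t, ω, h => by simp [chainValue, show ∀ k, t < (ω (0, k)).1 from h]
  | n + 1, x, t, ω, ⟨j, h1, h2, h3⟩ => by
    rw [chainValue_succ_of_firstJump h1 h2 (Set.mem_univ x)]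
    exact chainValue_univ_one h3

theorem tsum_chainValue_of_jumpCount {D : Set (Fin d → ℝ)} {H : (Fin d → ℝ) → ℝ≥0∞} {n : ℕ}
    {x : Fin d → ℝ} {t : ℝ} {ω : Sample d} (h : JumpCount n t ω) :
    ∑' m, chainValue D H m x t ω = chainValue D H n x t ω := by
  refine tsum_eq_single n fun m hm => ?_
  by_contra h0
  exact hm ((jumpCount_of_chainValue_ne_zero h0).unique h)

theorem jumpTime_restart_of_ne {j k : Fin d} (hk : k ≠ j) (ω : Sample d) (i : ℕ) :
    jumpTime (restart j ω) i k = jumpTime ω i k - (ω (0, j)).1 := by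
  rw [jumpTime, jumpTime, Finset.sum_range_succ', Finset.sum_range_succ']
  simp only [restart, hk, if_false, Nat.add_eq_zero_iff, one_ne_zero, and_false, if_true]
  ring

theorem jumpTime_restart_self (j : Fin d) (ω : Sample d) (i : ℕ) :
    jumpTime (restart j ω) i j = jumpTime ω (i + 1) j - (ω (0, j)).1 := by
  rw [jumpTime, jumpTime, Finset.sum_range_succ' _ (i + 1)]
  simp [restart]

theorem le_jumpTime {ω : Sample d} (h : ∀ p, 0 ≤ (ω p).1) (i : ℕ) (j : Fin d) :
    (ω (0, j)).1 ≤ jumpTime ω i j := by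
  rw [jumpTime, Finset.sum_range_succ']
  exact le_add_of_nonneg_left (Finset.sum_nonneg fun _ _ => h _)

theorem restart_nonneg {j : Fin d} {ω : Sample d} (hj : ω ∈ firstJump j)
    (h : ∀ p, 0 ≤ (ω p).1) (p : ℕ × Fin d) : 0 ≤ (restart j ω p).1 := by
  obtain ⟨i, k⟩ := p
  simp only [restart]
  split_ifs with h1 h2
  · exact h _
  · subst h2
    exact sub_nonneg.2 (hj.2 k h1).le
  · exact h _

/-- Finitely many steps of each walker are completed by a time at which the jumps can be counted. -/
theorem JumpCount.finite : ∀ {n : ℕ} {t : ℝ} {ω : Sample d}, (∀ p, 0 ≤ (ω p).1) →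
    JumpCount n t ω → ∀ k, {i | jumpTime ω i k ≤ t}.Finite
  | 0, t, ω, h, hc, k => by
    refine Set.Finite.subset Set.finite_empty fun i hi => ?_
    exact absurd ((hc k).trans_le (le_jumpTime h i k)) (not_lt.2 hi)
  | n + 1, t, ω, h, ⟨j, h1, _, h3⟩, k => by
    have ih := JumpCount.finite (restart_nonneg h1 h) h3 k
    by_cases hk : k = j
    · subst hk
      refine ((ih.image Nat.succ).insert 0).subset fun i hi => ?_
      cases i with
      | zero => exact Set.mem_insert _ _
      | succ i =>
        refine Set.mem_insert_of_mem _ ⟨i, ?_, rfl⟩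
        rw [Set.mem_ofPred_eq, jumpTime_restart_self]
        exact sub_le_sub_right hi _
    · refine ih.subset fun i hi => ?_
      rw [Set.mem_ofPred_eq, jumpTime_restart_of_ne hk]
      exact sub_le_sub_right hi _

/-- The samples with nonnegative waiting times in which every walker makes finitely many jumps in
finite time. -/
structure Regular (ω : Sample d) : Prop where
  nonneg : ∀ p, 0 ≤ (ω p).1
  finite : ∀ t k, {i | jumpTime ω i k ≤ t}.Finite

theorem Regular.restart {ω : Sample d} (h : Regular ω) {j : Fin d} (hj : ω ∈ firstJump j) :
    Regular (restart j ω) where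
  nonneg := restart_nonneg hj h.nonneg
  finite t k := by
    by_cases hk : k = j
    · subst hk
      refine ((h.finite (t + (ω (0, k)).1) k).preimage (Nat.succ_injective.injOn)).subset
        fun i hi => ?_
      rw [Set.mem_ofPred_eq, jumpTime_restart_self] at hi
      exact sub_le_iff_le_add.1 hi
    · refine (h.finite (t + (ω (0, j)).1) k).subset fun i hi => ?_
      rw [Set.mem_ofPred_eq, jumpTime_restart_of_ne hk] at hi
      exact sub_le_iff_le_add.1 hi

theorem walk_eq_of_lt {ω : Sample d} (h : Regular ω) {t : ℝ} (ht : ∀ k, t < (ω (0, k)).1)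
    (x : Fin d → ℝ) : walk x t ω = x := by
  ext k
  have : ∀ i, ¬ jumpTime ω i k ≤ t := fun i =>
    not_le.2 ((ht k).trans_le (le_jumpTime h.nonneg i k))
  simp [walk, this]

/-- The walk after the first jump is the walk of the restarted sample. -/
theorem walk_eq_restart {ω : Sample d} (h : Regular ω) {j : Fin d} (hj : ω ∈ firstJump j) {t : ℝ}
    (ht : (ω (0, j)).1 ≤ t) (x : Fin d → ℝ) :
    walk x t ω = walk (bump x j (ω (0, j)).2) (t - (ω (0, j)).1) (restart j ω) := by
  classical
  ext k
  simp only [walk, bump]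
  by_cases hk : k = j
  · subst hk
    have hs : Summable fun i : ℕ => if jumpTime ω i k ≤ t then (ω (i, k)).2 else 0 :=
      summable_of_hasFiniteSupport ((h.finite t k).subset fun i hi => by
        by_contra hc
        exact hi (if_neg hc))
    have h0 : jumpTime ω 0 k = (ω (0, k)).1 := by simp [jumpTime]
    rw [hs.tsum_eq_zero_add, if_pos rfl, h0, if_pos ht, add_assoc]
    congr 2
    refine tsum_congr fun i => ?_
    rw [jumpTime_restart_self]
    simp [OrderedWalk.restart]
  · rw [if_neg hk, add_zero]
    congr 1
    refine tsum_congr fun i => ?_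
    rw [jumpTime_restart_of_ne hk]
    simp only [sub_le_sub_iff_right]
    simp only [OrderedWalk.restart, hk, if_false]
    congr 1
    split_ifs <;> rfl

theorem staysIn_iff_of_lt {D : Set (Fin d → ℝ)} {ω : Sample d} (h : Regular ω) {t : ℝ}
    (ht0 : 0 ≤ t) (ht : ∀ k, t < (ω (0, k)).1) (x : Fin d → ℝ) : StaysIn D x t ω ↔ x ∈ D := by
  constructor
  · rintro ⟨r, hr, hs⟩
    have := hs t ht0 hr
    rwa [walk_eq_of_lt h ht] at this
  · intro hx
    obtain ⟨r, hr, hrt⟩ : ∃ r, t < r ∧ ∀ k, r ≤ (ω (0, k)).1 := by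
      have : ∀ᶠ r in 𝓝[>] t, ∀ k, r < (ω (0, k)).1 :=
        eventually_all.2 fun k => nhdsWithin_le_nhds (gt_mem_nhds (ht k))
      obtain ⟨r, hr1, hr2⟩ := (this.and self_mem_nhdsWithin).exists
      exact ⟨r, hr2, fun k => (hr1 k).le⟩
    refine ⟨r, hr, fun s _ hs => ?_⟩
    rwa [walk_eq_of_lt h fun k => hs.trans_le (hrt k)]

/-- The first jump comes after a positive time, so the walk staying in `D` sees the starting
point. -/
theorem staysIn_iff_restart {D : Set (Fin d → ℝ)} {ω : Sample d} (h : Regular ω) {j : Fin d}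
    (hj : ω ∈ firstJump j) {t : ℝ} (ht : (ω (0, j)).1 ≤ t) (x : Fin d → ℝ) :
    StaysIn D x t ω ↔ x ∈ D ∧
      StaysIn D (bump x j (ω (0, j)).2) (t - (ω (0, j)).1) (restart j ω) := by
  have hmin : ∀ k, (ω (0, j)).1 ≤ (ω (0, k)).1 := fun k => by
    by_cases hk : k = j
    · rw [hk]
    · exact (hj.2 k hk).le
  constructor
  · rintro ⟨r, hr, hs⟩
    refine ⟨?_, r - (ω (0, j)).1, by linarith, fun s hs0 hsr => ?_⟩
    · have := hs 0 le_rfl (by linarith [hj.1])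
      rwa [walk_eq_of_lt h fun k => hj.1.trans_le (hmin k)] at this
    · have := hs (s + (ω (0, j)).1) (by linarith [hj.1]) (by linarith)
      rwa [walk_eq_restart h hj (by linarith), add_sub_cancel_right] at this
  · rintro ⟨hx, r, hr, hs⟩
    refine ⟨r + (ω (0, j)).1, by linarith, fun s hs0 hsr => ?_⟩
    by_cases hsj : s < (ω (0, j)).1
    · rwa [walk_eq_of_lt h fun k => hsj.trans_le (hmin k)]
    · rw [walk_eq_restart h hj (not_lt.1 hsj)]
      exact hs _ (by linarith) (by linarith)

open Classical in
theorem chainValue_of_jumpCount {D : Set (Fin d → ℝ)} {H : (Fin d → ℝ) → ℝ≥0∞} :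
    ∀ {n : ℕ} {x : Fin d → ℝ} {t : ℝ} {ω : Sample d}, Regular ω → 0 ≤ t → JumpCount n t ω →
      chainValue D H n x t ω = if StaysIn D x t ω then H (walk x t ω) else 0
  | 0, x, t, ω, h, ht, hc => by
    have hc' : ∀ k, t < (ω (0, k)).1 := hc
    rw [chainValue, if_pos hc', walk_eq_of_lt h hc']
    simp only [staysIn_iff_of_lt h ht hc', Set.indicator_apply]
  | n + 1, x, t, ω, h, ht, ⟨j, h1, h2, h3⟩ => by
    by_cases hx : x ∈ D
    · rw [chainValue_succ_of_firstJump h1 h2 hx,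
        chainValue_of_jumpCount (h.restart h1) (sub_nonneg.2 h2) h3, walk_eq_restart h h1 h2]
      simp only [staysIn_iff_restart h h1 h2, hx, true_and]
    · rw [chainValue, Set.indicator_of_notMem hx, if_neg]
      exact fun hs => hx ((staysIn_iff_restart h h1 h2 x).1 hs).1

open Classical in
theorem measurable_chainValue {D : Set (Fin d → ℝ)} (hD : MeasurableSet D)
    {H : (Fin d → ℝ) → ℝ≥0∞} (hH : Measurable H) (n : ℕ) :
    Measurable fun p : (Fin d → ℝ) × ℝ × Sample d => chainValue D H n p.1 p.2.1 p.2.2 := by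
  induction n with
  | zero =>
    simp only [chainValue]
    refine Measurable.ite ?_ ((hH.indicator hD).comp measurable_fst) measurable_const
    have : {p : (Fin d → ℝ) × ℝ × Sample d | ∀ k, p.2.1 < (p.2.2 (0, k)).1} =
        ⋂ k, {p | p.2.1 < (p.2.2 (0, k)).1} := by ext p; simp
    rw [this]
    exact MeasurableSet.iInter fun k => measurableSet_lt (by fun_prop) (by fun_prop)
  | succ n ih =>
    have hsum : Measurable fun p : (Fin d → ℝ) × ℝ × Sample d => ∑ j,
        if p.2.2 ∈ firstJump j ∧ (p.2.2 (0, j)).1 ≤ p.2.1 then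
          chainValue D H n (bump p.1 j (p.2.2 (0, j)).2) (p.2.1 - (p.2.2 (0, j)).1)
            (restart j p.2.2) else 0 := by
      refine Finset.measurable_fun_sum _ fun j _ => ?_
      have h1 : Measurable fun p : (Fin d → ℝ) × ℝ × Sample d => (p.2.2 (0, j)).1 := by fun_prop
      have h2 : Measurable fun p : (Fin d → ℝ) × ℝ × Sample d => (p.2.2 (0, j)).2 := by fun_prop
      have h3 : Measurable fun p : (Fin d → ℝ) × ℝ × Sample d => p.2.1 := by fun_prop
      refine Measurable.ite ?_ ?_ measurable_const
      · exact ((measurableSet_firstJump j).preimage (measurable_snd.comp measurable_snd)).inter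
          (measurableSet_le h1 h3)
      · exact ih.comp (((measurable_bump_prod j).comp (measurable_fst.prodMk h2)).prodMk
          ((h3.sub h1).prodMk ((measurable_restart j).comp
            (measurable_snd.comp measurable_snd))))
    have := hsum.indicator (measurable_fst hD)
    exact this

theorem lintegral_Ioc_pow {t : ℝ} (ht : 0 ≤ t) (n : ℕ) :
    ∫⁻ s in Set.Ioc 0 t, ENNReal.ofReal ((t - s) ^ n / n.factorial) =
      ENNReal.ofReal (t ^ (n + 1) / (n + 1).factorial) := by
  have hint : IntegrableOn (fun s : ℝ => (t - s) ^ n / n.factorial) (Set.Ioc 0 t) :=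
    (((by fun_prop : Continuous fun s : ℝ => (t - s) ^ n / n.factorial).integrableOn_Icc)).mono_set
      Set.Ioc_subset_Icc_self
  rw [← ofReal_integral_eq_lintegral_ofReal hint ((ae_restrict_iff' measurableSet_Ioc).2
    (ae_of_all _ fun s hs => div_nonneg (pow_nonneg (sub_nonneg.2 hs.2) _) (by positivity))),
    ← intervalIntegral.integral_of_le ht, intervalIntegral.integral_div,
    intervalIntegral.integral_comp_sub_left (fun s => s ^ n), integral_pow, Nat.factorial_succ]
  congr 1
  push_cast
  field_simp
  simp

theorem measure_stepLaw_gt (μ : Measure ℝ) [IsProbabilityMeasure μ] {t : ℝ} (ht : 0 ≤ t) :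
    stepLaw μ {q | t < q.1} = ENNReal.ofReal (Real.exp (-t)) := by
  have := congrArg (fun m : Measure (ℝ × ℝ) => m Set.univ) (map_sub_stepLaw μ ht)
  simpa [Measure.map_apply (by fun_prop : Measurable fun q : ℝ × ℝ => (q.1 - t, q.2))
    MeasurableSet.univ] using this

theorem measure_forall_gt (μ : Measure ℝ) [IsProbabilityMeasure μ] {t : ℝ} (ht : 0 ≤ t) :
    walkMeasure μ d {ω | ∀ k, t < (ω (0, k)).1} = ENNReal.ofReal (Real.exp (-(d * t))) := by
  let I : Finset (ℕ × Fin d) := Finset.univ.map ⟨fun k => (0, k), fun k k' h => by simpa using h⟩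
  have hset : {ω : Sample d | ∀ k, t < (ω (0, k)).1} =
      (I : Set (ℕ × Fin d)).pi fun _ => {q : ℝ × ℝ | t < q.1} := by
    ext ω; simp [I]; rfl
  rw [hset, walkMeasure_eq, Measure.infinitePi_pi _ fun _ _ =>
    measurableSet_lt measurable_const measurable_fst]
  simp only [measure_stepLaw_gt μ ht, Finset.prod_const]
  have hI : I.card = d := by simp [I]
  rw [hI, ← ENNReal.ofReal_pow (Real.exp_pos _).le, ← Real.exp_nat_mul]
  ring_nf

/-- The number of jumps by time `t` is Poisson of mean `d t`, and given this number the walkers that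
jump form a uniformly distributed word. -/
theorem lintegral_chainValue (μ : Measure ℝ) [IsProbabilityMeasure μ] {D : Set (Fin d → ℝ)}
    (hD : MeasurableSet D) {H : (Fin d → ℝ) → ℝ≥0∞} (hH : Measurable H) (n : ℕ) :
    ∀ (x : Fin d → ℝ) {t : ℝ}, 0 ≤ t →
      ∫⁻ ω, chainValue D H n x t ω ∂(walkMeasure μ d) =
        ENNReal.ofReal (Real.exp (-(d * t)) * (t ^ n / n.factorial)) * killedIter μ D H n x := by
  induction n with
  | zero =>
    intro x t ht
    have hm : MeasurableSet {ω : Sample d | ∀ k, t < (ω (0, k)).1} := by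
      have : {ω : Sample d | ∀ k, t < (ω (0, k)).1} = ⋂ k, {ω | t < (ω (0, k)).1} := by
        ext ω; simp
      rw [this]
      exact MeasurableSet.iInter fun k => measurableSet_lt measurable_const (by fun_prop)
    have : ∀ ω : Sample d, chainValue D H 0 x t ω =
        {ω : Sample d | ∀ k, t < (ω (0, k)).1}.indicator (fun _ => D.indicator H x) ω := by
      intro ω
      by_cases h : ω ∈ {ω : Sample d | ∀ k, t < (ω (0, k)).1}
      · rw [Set.indicator_of_mem h, chainValue]
        exact if_pos h
      · rw [Set.indicator_of_notMem h, chainValue]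
        exact if_neg h
    rw [lintegral_congr this, lintegral_indicator_const hm, measure_forall_gt μ ht, mul_comm]
    simp [killedIter]
  | succ n ih =>
    intro x t ht
    classical
    by_cases hx : x ∈ D
    · have hmeas := measurable_chainValue hD hH n
      let F : Fin d → ℝ → ℝ → Sample d → ℝ≥0∞ := fun j s y ω =>
        (Set.Iic t).indicator (fun s => chainValue D H n (bump x j y) (t - s) ω) s
      have hF : ∀ j, Measurable fun p : ℝ × ℝ × Sample d => F j p.1 p.2.1 p.2.2 := by
        intro j
        have h1 : Measurable fun p : ℝ × ℝ × Sample d =>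
            chainValue D H n (bump x j p.2.1) (t - p.1) p.2.2 :=
          hmeas.comp (((measurable_bump x j).comp (by fun_prop)).prodMk
            (Measurable.prodMk (by fun_prop) (by fun_prop)))
        exact h1.indicator (measurable_fst measurableSet_Iic)
      have hrec : ∀ ω, chainValue D H (n + 1) x t ω = ∑ j, (firstJump j).indicator
          (fun ω => F j (ω (0, j)).1 (ω (0, j)).2 (restart j ω)) ω := by
        intro ω
        rw [chainValue, Set.indicator_of_mem hx]
        refine Finset.sum_congr rfl fun j _ => ?_
        by_cases h1 : ω ∈ firstJump j <;> by_cases h2 : (ω (0, j)).1 ≤ t <;>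
          simp [F, h1, h2, Set.indicator_apply]
      have hmF : ∀ j, Measurable fun ω : Sample d =>
          F j (ω (0, j)).1 (ω (0, j)).2 (restart j ω) := fun j =>
        (hF j).comp ((measurable_fst.comp (measurable_pi_apply _)).prodMk
          ((measurable_snd.comp (measurable_pi_apply _)).prodMk (measurable_restart j)))
      rw [lintegral_congr hrec, lintegral_finsetSum _ fun j _ =>
        (hmF j).indicator (measurableSet_firstJump j)]
      change _ = _ * killedStep μ D (killedIter μ D H n) x
      rw [killedStep_of_mem hx, Finset.mul_sum]
      refine Finset.sum_congr rfl fun j _ => ?_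
      rw [lintegral_indicator (measurableSet_firstJump j), lintegral_firstJump μ j (hF j)]
      have hin : ∀ s ∈ Set.Ioi (0 : ℝ), ENNReal.ofReal (Real.exp (-(d * s))) *
          ∫⁻ y, ∫⁻ ω, F j s y ω ∂(walkMeasure μ d) ∂μ =
          (Set.Iic t).indicator (fun s => ENNReal.ofReal ((t - s) ^ n / n.factorial)) s *
            (ENNReal.ofReal (Real.exp (-(d * t))) *
              ∫⁻ y, killedIter μ D H n (bump x j y) ∂μ) := by
        intro s _
        by_cases hs : s ∈ Set.Iic t
        · have hts : 0 ≤ t - s := sub_nonneg.2 hs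
          simp only [F, Set.indicator_of_mem hs]
          rw [lintegral_congr fun y => ih (bump x j y) hts, lintegral_const_mul' _ _
            ENNReal.ofReal_ne_top, ← mul_assoc, ← mul_assoc,
            ← ENNReal.ofReal_mul (Real.exp_pos _).le, ← ENNReal.ofReal_mul (by positivity),
            ← mul_assoc, ← Real.exp_add]
          congr 2
          rw [mul_comm]
          ring_nf
        · simp [F, Set.indicator_of_notMem hs]
      rw [setLIntegral_congr_fun measurableSet_Ioi hin, lintegral_mul_const _
        (Measurable.indicator (by fun_prop) measurableSet_Iic),
        setLIntegral_indicator measurableSet_Iic, Set.inter_comm, Set.Ioi_inter_Iic,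
        lintegral_Ioc_pow ht, ← mul_assoc, ← ENNReal.ofReal_mul (by positivity), mul_comm (_ / _)]
    · have h1 : ∀ ω, chainValue D H (n + 1) x t ω = 0 := fun ω => by
        rw [chainValue, Set.indicator_of_notMem hx]
      have h2 : killedIter μ D H (n + 1) x = 0 := killedStep_of_notMem hx
      rw [lintegral_congr h1, h2]
      simp

theorem killedIter_univ_one (μ : Measure ℝ) [IsProbabilityMeasure μ] (n : ℕ) :
    ∀ x : Fin d → ℝ, killedIter μ Set.univ (fun _ => 1) n x = (d : ℝ≥0∞) ^ n := by
  induction n with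
  | zero => intro x; simp [killedIter]
  | succ n ih =>
    intro x
    rw [killedIter, killedStep_of_mem (Set.mem_univ x)]
    simp [ih, pow_succ']

theorem ofReal_weight_mul_pow {t : ℝ} (ht : 0 ≤ t) (n : ℕ) :
    ENNReal.ofReal (Real.exp (-(d * t)) * (t ^ n / n.factorial)) * (d : ℝ≥0∞) ^ n =
      ENNReal.ofReal (poissonWeight (d * t) n) := by
  rw [← ENNReal.ofReal_natCast d, ← ENNReal.ofReal_pow (Nat.cast_nonneg d),
    ← ENNReal.ofReal_mul (by positivity), poissonWeight, mul_pow]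
  congr 1
  ring

/-- Almost surely there are finitely many jumps by time `t`, at distinct times: the Poisson
probabilities of the possible numbers of jumps add up to `1`. -/
theorem ae_exists_jumpCount (μ : Measure ℝ) [IsProbabilityMeasure μ] {t : ℝ} (ht : 0 ≤ t) :
    ∀ᵐ ω ∂(walkMeasure μ d), ∃ n, JumpCount n t ω := by
  let f : Sample d → ℝ≥0∞ := fun ω => ∑' n, chainValue Set.univ (fun _ => 1) n 0 t ω
  have hmeas : ∀ n, Measurable fun ω : Sample d => chainValue Set.univ (fun _ => 1) n 0 t ω :=
    fun n => (measurable_chainValue MeasurableSet.univ measurable_const n).comp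
      (measurable_const.prodMk (measurable_const.prodMk measurable_id))
  have hle : ∀ ω, f ω ≤ 1 := by
    intro ω
    by_cases h : ∃ n, JumpCount n t ω
    · obtain ⟨n, hn⟩ := h
      exact (tsum_chainValue_of_jumpCount hn).trans_le (chainValue_univ_one hn).le
    · refine le_of_eq_of_le ?_ zero_le_one
      refine ENNReal.tsum_eq_zero.2 fun n => ?_
      by_contra h0
      exact h ⟨n, jumpCount_of_chainValue_ne_zero h0⟩
  have hint : ∫⁻ ω, f ω ∂(walkMeasure μ d) = 1 := by
    rw [lintegral_tsum fun n => (hmeas n).aemeasurable]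
    have : ∀ n, ∫⁻ ω, chainValue Set.univ (fun _ => 1) n 0 t ω ∂(walkMeasure μ d) =
        ENNReal.ofReal (poissonWeight (d * t) n) := fun n => by
      rw [lintegral_chainValue μ MeasurableSet.univ measurable_const n 0 ht,
        killedIter_univ_one, ofReal_weight_mul_pow ht]
    simp_rw [this]
    have hs := hasSum_poissonWeight (d * t)
    rw [← ENNReal.ofReal_tsum_of_nonneg (poissonWeight_nonneg (by positivity)) hs.summable,
      hs.tsum_eq, ENNReal.ofReal_one]
  have hae : f =ᵐ[walkMeasure μ d] fun _ => 1 := by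
    refine ae_eq_of_ae_le_of_lintegral_le (ae_of_all _ hle) (by rw [hint]; simp)
      aemeasurable_const ?_
    rw [hint]
    simp
  filter_upwards [hae] with ω hω
  by_contra h
  push Not at h
  have : f ω = 0 := ENNReal.tsum_eq_zero.2 fun n => by
    by_contra h0
    exact h n (jumpCount_of_chainValue_ne_zero h0)
  simp [this] at hω

theorem ae_regular (μ : Measure ℝ) [IsProbabilityMeasure μ] :
    ∀ᵐ ω ∂(walkMeasure μ d), Regular ω := by
  have h1 : ∀ᵐ ω ∂(walkMeasure μ d), ∀ p, 0 ≤ (ω p).1 := by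
    refine ae_all_iff.2 fun p => ?_
    have hpos : ∀ᵐ q ∂(stepLaw μ), 0 ≤ q.1 := by
      have h2 : stepLaw μ {q | 0 < q.1} = 1 := by
        rw [measure_stepLaw_gt μ le_rfl]; simp
      have hm : MeasurableSet {q : ℝ × ℝ | 0 < q.1} :=
        measurableSet_lt measurable_const measurable_fst
      have h3 : ∀ᵐ q ∂(stepLaw μ), q ∈ {q : ℝ × ℝ | 0 < q.1} :=
        (prob_compl_eq_zero_iff hm).2 h2
      exact h3.mono fun q hq => le_of_lt hq
    exact (measurePreserving_eval_infinitePi (fun _ : ℕ × Fin d => stepLaw μ)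
      p).quasiMeasurePreserving.ae hpos
  have h2 : ∀ᵐ ω ∂(walkMeasure μ d), ∀ m : ℕ, ∃ n, JumpCount n (m : ℝ) ω :=
    ae_all_iff.2 fun m => ae_exists_jumpCount μ (Nat.cast_nonneg m)
  filter_upwards [h1, h2] with ω hω1 hω2
  refine ⟨hω1, fun t k => ?_⟩
  obtain ⟨m, hm⟩ := exists_nat_ge t
  obtain ⟨n, hn⟩ := hω2 m
  exact (hn.finite hω1 k).subset fun i hi => le_trans hi hm

open Classical in
/-- Almost surely the killed value at time `t` is recovered from the recursion over the number of
jumps. -/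
theorem ae_tsum_chainValue (μ : Measure ℝ) [IsProbabilityMeasure μ] (D : Set (Fin d → ℝ))
    (H : (Fin d → ℝ) → ℝ≥0∞) (x : Fin d → ℝ) {t : ℝ} (ht : 0 ≤ t) :
    ∀ᵐ ω ∂(walkMeasure μ d), ∑' n, chainValue D H n x t ω =
      if StaysIn D x t ω then H (walk x t ω) else 0 := by
  filter_upwards [ae_regular μ, ae_exists_jumpCount μ ht] with ω h1 ⟨n, hn⟩
  rw [tsum_chainValue_of_jumpCount hn, chainValue_of_jumpCount h1 ht hn]

/-! ### The harmonic function -/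

/-- The killed expectation at time `t` is the average of the normalized killed iterates over the
Poisson number of jumps. -/
theorem killedVandermonde_eq_tsum (μ : Measure ℝ) [IsProbabilityMeasure μ] (hd : 1 ≤ d)
    {x : Fin d → ℝ} {B : ℝ}
    (hB : ∀ n, killedIter μ (weylChamber d) vandermondeE n x ≤ ENNReal.ofReal (d ^ n * B))
    {t : ℝ} (ht : 0 ≤ t) :
    IntegrableOn (fun ω => vandermonde (walk x t ω)) (survival x t) (walkMeasure μ d) ∧
      killedVandermonde μ x t = ∑' n, poissonWeight (d * t) n *
        ((killedIter μ (weylChamber d) vandermondeE n x).toReal / d ^ n) := by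
  set P := walkMeasure μ d with hP
  have hW := measurableSet_weylChamber d
  have hmeas : ∀ H : (Fin d → ℝ) → ℝ≥0∞, Measurable H →
      ∀ n, Measurable fun ω : Sample d => chainValue (weylChamber d) H n x t ω :=
    fun H hH n => (measurable_chainValue hW hH n).comp
      (measurable_const.prodMk (measurable_const.prodMk measurable_id))
  let f : Sample d → ℝ≥0∞ := fun ω => ∑' n, chainValue (weylChamber d) vandermondeE n x t ω
  let g : Sample d → ℝ≥0∞ := fun ω => ∑' n, chainValue (weylChamber d) (fun _ => 1) n x t ω
  have hf : Measurable f := Measurable.tsum (hmeas _ measurable_vandermondeE)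
  have hg : Measurable g := Measurable.tsum (hmeas _ measurable_const)
  -- a measurable version of the event of survival
  let A : Set (Sample d) := {ω | g ω = 1}
  have hA : MeasurableSet A := hg (measurableSet_singleton 1)
  have hsurv : survival x t =ᵐ[P] A := by
    filter_upwards [ae_tsum_chainValue μ (weylChamber d) (fun _ => 1) x ht] with ω hω
    refine propext ?_
    change ω ∈ survival x t ↔ g ω = 1
    rw [mem_survival_iff]
    change g ω = _ at hω
    rw [hω]
    split_ifs with h <;> simp [h]
  have hind : (fun ω => (f ω).toReal) =ᵐ[P]
      A.indicator fun ω => vandermonde (walk x t ω) := by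
    filter_upwards [ae_tsum_chainValue μ (weylChamber d) vandermondeE x ht, hsurv] with ω hω hωA
    have hiff : ω ∈ survival x t ↔ ω ∈ A := hωA.to_iff
    rw [mem_survival_iff] at hiff
    change f ω = _ at hω
    rw [hω]
    by_cases h : StaysIn (weylChamber d) x t ω
    · rw [if_pos h, Set.indicator_of_mem (hiff.1 h), vandermondeE, ENNReal.toReal_ofReal]
      obtain ⟨r, hr, hs⟩ := h
      exact (vandermonde_pos (hs t ht hr)).le
    · rw [if_neg h, Set.indicator_of_notMem fun h' => h (hiff.2 h')]
      rfl
  let q : ℕ → ℝ := fun n => (killedIter μ (weylChamber d) vandermondeE n x).toReal / d ^ n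
  have hd0 : (0 : ℝ) < d := by exact_mod_cast hd
  have hq0 : ∀ n, 0 ≤ q n := fun n => by positivity
  have hB0 : 0 ≤ max B 0 := le_max_right _ _
  have hqB : ∀ n, q n ≤ max B 0 := by
    intro n
    have h1 : killedIter μ (weylChamber d) vandermondeE n x ≤
        ENNReal.ofReal (d ^ n * max B 0) :=
      (hB n).trans (ENNReal.ofReal_le_ofReal
        (mul_le_mul_of_nonneg_left (le_max_left _ _) (by positivity)))
    have h2 := ENNReal.toReal_mono ENNReal.ofReal_ne_top h1
    rw [ENNReal.toReal_ofReal (by positivity)] at h2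
    exact (div_le_iff₀ (by positivity)).2 (by linarith)
  have hw := hasSum_poissonWeight (d * t)
  have hw0 : ∀ n, 0 ≤ poissonWeight (d * t) n := poissonWeight_nonneg (by positivity)
  have hsum : Summable fun n => poissonWeight (d * t) n * q n :=
    Summable.of_nonneg_of_le (fun n => mul_nonneg (hw0 n) (hq0 n))
      (fun n => mul_le_mul_of_nonneg_left (hqB n) (hw0 n)) (hw.summable.mul_right _)
  have hlint : ∫⁻ ω, f ω ∂P = ENNReal.ofReal (∑' n, poissonWeight (d * t) n * q n) := by
    rw [ENNReal.ofReal_tsum_of_nonneg (fun n => mul_nonneg (hw0 n) (hq0 n)) hsum,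
      lintegral_tsum fun n => (hmeas _ measurable_vandermondeE n).aemeasurable]
    refine tsum_congr fun n => ?_
    have hfin : killedIter μ (weylChamber d) vandermondeE n x ≠ ⊤ :=
      ((hB n).trans_lt ENNReal.ofReal_lt_top).ne
    have hdq : killedIter μ (weylChamber d) vandermondeE n x =
        (d : ℝ≥0∞) ^ n * ENNReal.ofReal (q n) := by
      rw [← ENNReal.ofReal_natCast d, ← ENNReal.ofReal_pow hd0.le,
        ← ENNReal.ofReal_mul (by positivity), mul_div_cancel₀ _ (by positivity),
        ENNReal.ofReal_toReal hfin]
    rw [lintegral_chainValue μ hW measurable_vandermondeE n x ht, hdq, ← mul_assoc,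
      ofReal_weight_mul_pow ht, ENNReal.ofReal_mul (hw0 n)]
  have hlfin : ∫⁻ ω, f ω ∂P ≠ ⊤ := by rw [hlint]; exact ENNReal.ofReal_ne_top
  constructor
  · rw [IntegrableOn, Measure.restrict_congr_set hsurv, ← IntegrableOn,
      ← integrable_indicator_iff hA]
    exact (integrable_toReal_of_lintegral_ne_top hf.aemeasurable hlfin).congr hind
  · rw [killedVandermonde, Measure.restrict_congr_set hsurv, ← integral_indicator hA,
      ← integral_congr_ae hind, integral_toReal hf.aemeasurable
        (ae_lt_top' hf.aemeasurable hlfin), hlint, ENNReal.toReal_ofReal]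
    exact tsum_nonneg fun n => mul_nonneg (hw0 n) (hq0 n)

theorem mul_rpow_le_sub_of_mem_spacedSet {T ε : ℝ} {x : Fin d → ℝ} (hx : x ∈ spacedSet d T ε) :
    ∀ (m i : ℕ) (h : i + m < d), m * T ^ (1 / 2 - ε) ≤ x ⟨i + m, h⟩ - x ⟨i, by omega⟩
  | 0, i, h => by simp
  | m + 1, i, h => by
    have h1 := mul_rpow_le_sub_of_mem_spacedSet hx m i (by omega)
    have h2 := hx (i + m) (by omega)
    push_cast
    have h3 : x ⟨i + (m + 1), h⟩ = x ⟨i + m + 1, by omega⟩ := rfl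
    rw [h3]
    linarith

theorem rpow_mul_le_sub_of_mem_spacedSet {T ε : ℝ} {x : Fin d → ℝ} (hx : x ∈ spacedSet d T ε)
    {i k : Fin d} (hik : i < k) :
    T ^ (1 / 2 - ε) * (((k : ℕ) : ℝ) - (i : ℕ)) ≤ x k - x i := by
  have h0 := Fin.lt_def.1 hik
  have h := mul_rpow_le_sub_of_mem_spacedSet hx ((k : ℕ) - i) i (by have := k.2; omega)
  have hk : (⟨(i : ℕ) + ((k : ℕ) - i), by have := k.2; omega⟩ : Fin d) = k :=
    Fin.ext (by simp only; omega)
  rw [hk, Nat.cast_sub h0.le] at h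
  linarith

/-- When the gaps are large compared to `R d²`, spreading the configuration by `R` changes the
determinant by a bounded factor. -/
theorem vandermonde_spread_le {L R : ℝ} (hL : 0 < L) (hR : 0 ≤ R) (hRL : R * (d * d) ≤ L)
    {x : Fin d → ℝ}
    (hx : ∀ i k : Fin d, i < k → L * (((k : ℕ) : ℝ) - (i : ℕ)) ≤ x k - x i) :
    vandermonde (spread R x) ≤ Real.exp 1 * vandermonde x := by
  have hgap : ∀ i k : Fin d, i < k → (0 : ℝ) < ((k : ℕ) : ℝ) - (i : ℕ) := fun i k h =>
    sub_pos.2 (by exact_mod_cast h)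
  have hpos : ∀ i k : Fin d, i < k → 0 < x k - x i := fun i k h =>
    (mul_pos hL (hgap i k h)).trans_le (hx i k h)
  have h1 : vandermonde (spread R x) ≤
      ∏ i : Fin d, ∏ k ∈ Finset.Ioi i, (x k - x i) * Real.exp (R / L) := by
    refine Finset.prod_le_prod (fun i _ => Finset.prod_nonneg fun k hk => ?_) fun i _ =>
      Finset.prod_le_prod (fun k hk => ?_) fun k hk => ?_
    all_goals
      have hik := Finset.mem_Ioi.1 hk
      have hg := hgap i k hik
      have hp := hpos i k hik
      simp only [spread]
    · nlinarith [mul_nonneg hR hg.le]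
    · nlinarith [mul_nonneg hR hg.le]
    · have h2 : R * (((k : ℕ) : ℝ) - (i : ℕ)) ≤ (x k - x i) * (R / L) := by
        calc R * (((k : ℕ) : ℝ) - (i : ℕ)) = L * (((k : ℕ) : ℝ) - (i : ℕ)) * (R / L) := by
              field_simp
          _ ≤ _ := mul_le_mul_of_nonneg_right (hx i k hik) (by positivity)
      have h3 := mul_le_mul_of_nonneg_left (Real.add_one_le_exp (R / L)) hp.le
      linarith
  refine h1.trans ?_
  simp_rw [Finset.prod_mul_distrib]
  rw [mul_comm]
  refine mul_le_mul_of_nonneg_right ?_ (Finset.prod_nonneg fun i _ => Finset.prod_nonneg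
    fun k hk => (hpos i k (Finset.mem_Ioi.1 hk)).le)
  have hE : 1 ≤ Real.exp (R / L) := Real.one_le_exp (by positivity)
  calc ∏ i : Fin d, ∏ _k ∈ Finset.Ioi i, Real.exp (R / L)
      ≤ ∏ _i : Fin d, Real.exp (R / L) ^ d := by
        refine Finset.prod_le_prod (fun i _ => by positivity) fun i _ => ?_
        rw [Finset.prod_const]
        refine pow_le_pow_right₀ hE ?_
        exact (Finset.card_le_univ _).trans_eq (Fintype.card_fin d)
    _ = Real.exp (d * d * (R / L)) := by
        rw [Finset.prod_const, Finset.card_univ, Fintype.card_fin, ← pow_mul, ← Real.exp_nat_mul]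
        push_cast
        ring_nf
    _ ≤ Real.exp 1 := by
        refine Real.exp_le_exp.2 ?_
        rw [mul_div_assoc', div_le_one hL]
        linarith

theorem tendsto_log_div_rpow {b c : ℝ} (hc : 0 < c) :
    Tendsto (fun T : ℝ => 2 * (1 + b * Real.log T) / T ^ c) atTop (𝓝 0) := by
  have h1 : Tendsto (fun T : ℝ => Real.log T / T ^ c) atTop (𝓝 0) :=
    (isLittleO_log_rpow_atTop hc).tendsto_div_nhds_zero
  have h2 : Tendsto (fun T : ℝ => (T ^ c)⁻¹) atTop (𝓝 0) :=
    (tendsto_rpow_atTop hc).inv_tendsto_atTop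
  have := (h2.const_mul 2).add (h1.const_mul (2 * b))
  simp only [mul_zero, add_zero] at this
  refine this.congr fun T => ?_
  ring

end OrderedWalk

theorem mainTheorem3 (μ : MeasureTheory.Measure ℝ) [MeasureTheory.IsProbabilityMeasure μ]
    (hmean : ∫ y, y ∂μ = 0)
    (hvar : ProbabilityTheory.variance (fun y : ℝ => y) μ = 1)
    (hexp : ∃ δ₀ : ℝ, 0 < δ₀ ∧ ∀ δ : ℝ, -δ₀ < δ → δ < δ₀ →
      MeasureTheory.Integrable (fun y : ℝ => Real.exp (δ * y)) μ)
    (hlc : ∃ f : ℝ → ℝ, OrderedWalk.IsLogConcaveDensity μ f)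
    (ε a : ℝ) (hε : 0 < ε) (ha : 2 * a < 1 / 2 - ε) :
    ∀ η : ℝ, 0 < η → ∃ T₀ : ℝ, 0 < T₀ ∧ ∀ T : ℝ, T₀ ≤ T →
      ∀ d : ℕ, 1 ≤ d → (d : ℝ) ≤ T ^ a → ∀ x ∈ OrderedWalk.spacedSet d T ε,
        (∀ t : ℝ, 0 ≤ t → MeasureTheory.IntegrableOn
          (fun ω => OrderedWalk.vandermonde (OrderedWalk.walk x t ω))
          (OrderedWalk.survival x t) (OrderedWalk.walkMeasure μ d)) ∧
        Filter.Tendsto (fun t : ℝ => OrderedWalk.killedVandermonde μ x t) Filter.atTop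
          (nhds (OrderedWalk.harmonicV μ x)) ∧
        |OrderedWalk.harmonicV μ x / OrderedWalk.vandermonde x - 1| ≤ η := by
  intro η hη
  obtain ⟨δ₀, hδ₀, hexp⟩ := hexp
  obtain ⟨f, hf⟩ := hlc
  obtain ⟨r, M, hexc⟩ := hf.exists_excessBound hδ₀ hexp
  have hr := hexc.rate_pos
  have hM := hexc.const_pos
  have hmom : ∀ n : ℕ, Integrable (fun y : ℝ => y ^ n) μ := fun n =>
    integrable_pow_of_integrable_exp_mul (X := fun y => y) (half_pos hδ₀).ne'
      (hexp _ (by linarith) (by linarith)) (hexp _ (by linarith) (by linarith)) n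
  -- the spread `R = T ^ c` satisfies `R d² ≤ T ^ (1 / 2 - ε)`, and `log d` is negligible against it
  set c := 1 / 2 - ε - 2 * a with hc
  have hc0 : 0 < c := by linarith
  have hlim := OrderedWalk.tendsto_log_div_rpow (b := a) hc0
  have hsmall : Tendsto (fun T : ℝ => 4 * M / (r * T ^ c) * Real.exp 1) atTop (𝓝 0) := by
    have h := ((tendsto_rpow_atTop hc0).inv_tendsto_atTop).const_mul (4 * M / r * Real.exp 1)
    rw [mul_zero] at h
    refine h.congr fun T => ?_
    rw [Pi.inv_apply, mul_comm r, div_mul_eq_div_div]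
    ring
  have hev : ∀ᶠ T : ℝ in atTop, (2 * (1 + a * Real.log T) / T ^ c ≤ r / 2 ∧
      2 * (1 + a * Real.log T) / T ^ c ≤ r / 4 / M) ∧
      4 * M / (r * T ^ c) * Real.exp 1 ≤ η :=
    ((hlim.eventually (ge_mem_nhds (by positivity))).and
      (hlim.eventually (ge_mem_nhds (by positivity)))).and
      (hsmall.eventually (ge_mem_nhds hη))
  obtain ⟨T₁, hT₁⟩ := eventually_atTop.1 hev
  refine ⟨max T₁ 1, by positivity, fun T hT d hd hdT x hx => ?_⟩
  obtain ⟨⟨hθ₁, hθ₂⟩, hκ⟩ := hT₁ T ((le_max_left _ _).trans hT)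
  have hT0 : 0 < T := one_pos.trans_le ((le_max_right _ _).trans hT)
  have hd0 : (0 : ℝ) < d := by exact_mod_cast hd
  set R := T ^ c with hRdef
  have hR : 0 < R := Real.rpow_pos_of_pos hT0 _
  set L := T ^ (1 / 2 - ε) with hLdef
  have hL : 0 < L := Real.rpow_pos_of_pos hT0 _
  have hRL : R * (d * d) ≤ L := by
    calc R * (d * d) ≤ R * (T ^ a * T ^ a) := by gcongr
      _ = L := by
        rw [hRdef, hLdef, ← Real.rpow_add hT0, ← Real.rpow_add hT0]
        congr 1
        rw [hc]; ring
  have hlog : Real.log d ≤ a * Real.log T := by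
    rw [← Real.log_rpow hT0]
    exact Real.log_le_log hd0 hdT
  have hrate : OrderedWalk.changeRate d R ≤ 2 * (1 + a * Real.log T) / R := by
    rw [OrderedWalk.changeRate]
    gcongr
  have hgap : ∀ i k : Fin d, i < k → L * (((k : ℕ) : ℝ) - (i : ℕ)) ≤ x k - x i :=
    fun i k h => OrderedWalk.rpow_mul_le_sub_of_mem_spacedSet hx h
  have hxW : x ∈ OrderedWalk.weylChamber d := fun i k h => by
    have h1 : (0 : ℝ) < ((k : ℕ) : ℝ) - (i : ℕ) := sub_pos.2 (by exact_mod_cast h)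
    have h2 := mul_pos hL h1
    linarith [hgap i k h]
  obtain ⟨hB, V, hV, hVx⟩ := OrderedWalk.exists_tendsto_killedIter hexc hmom hd hR
    (hrate.trans hθ₁) ((le_div_iff₀ hM).1 (hrate.trans hθ₂)) hxW
  have hlimV : Tendsto (fun t : ℝ => OrderedWalk.killedVandermonde μ x t) atTop (𝓝 V) := by
    refine ((OrderedWalk.tendsto_tsum_poissonWeight hV).comp
      (tendsto_id.const_mul_atTop hd0)).congr' ?_
    filter_upwards [eventually_ge_atTop 0] with t ht
    exact (OrderedWalk.killedVandermonde_eq_tsum μ hd hB ht).2.symm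
  have hVeq : OrderedWalk.harmonicV μ x = V := hlimV.limUnder_eq
  refine ⟨fun t ht => (OrderedWalk.killedVandermonde_eq_tsum μ hd hB ht).1, hVeq ▸ hlimV, ?_⟩
  have hΔ := OrderedWalk.vandermonde_pos hxW
  rw [hVeq, div_sub_one hΔ.ne', abs_div, abs_of_pos hΔ, div_le_iff₀ hΔ]
  calc |V - OrderedWalk.vandermonde x|
      ≤ 4 * M / (r * R) * OrderedWalk.vandermonde (OrderedWalk.spread R x) := hVx
    _ ≤ 4 * M / (r * R) * (Real.exp 1 * OrderedWalk.vandermonde x) := by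
        gcongr
        exact OrderedWalk.vandermonde_spread_le hL hR.le hRL hgap
    _ = 4 * M / (r * R) * Real.exp 1 * OrderedWalk.vandermonde x := by ring
    _ ≤ η * OrderedWalk.vandermonde x := by gcongr
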